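/- Let $L\ge 1$ be an integer divisible by $3$, and let $\Lambda=\mathbb B/L\mathbb B$, where $\mathbb B$ is the triangular lattice generated by $\vec a_{1}=\frac12(3,\sqrt3)$, $\vec a_2=\frac12(3,-\sqrt3)$. Put $\vec b_{1}=\frac{2\pi}{3}(1,\sqrt3)$, $\vec b_2=\frac{2\pi}{3}(1,-\sqrt3)$ (dual basis), $\vec\delta_1=(1,0)$, $\vec\delta_{2}=\frac12(-1,\sqrt3)$, $\vec\delta_3=\frac12(-1,-\sqrt3)$, $\vec p_F^{\,+}=\big(\frac{2\pi}{3},\frac{2\pi}{3\sqrt3}\big)$, $\Lambda_A=\Lambda$, $\Lambda_B=\Lambda+\vec\delta_1$, and let $\mathcal A_\Lambda=\frac{3\sqrt3}{2}L^2$ be the area of $\Lambda$ and $|\Lambda|=L^2$. Electrons: for $\vec x\in\Lambda$ and $\sigma=\uparrow,\downarrow$ let $a^\pm_{\vec x,\sigma}$ and $b^\pm_{\vec x+\vec\delta_1,\sigma}$ be fermionic creation/annihilation operators on the sites of $\Lambda_A$ and $\Lambda_B$ (periodic boundary conditions, canonical anticommutation relations, fermionic Fock space), and let $n_{\vec x}$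 be the density operator at a site. Photons: let the momenta be $\underline p=\big(\vec p,p_3\big)=\big(\frac{n_1}{L}\vec b_1+\frac{n_2}{L}\vec b_2,\frac{2\pi n_3}{L}\big)\ne 0$, $n\in\mathbb Z^3$, and let $c^\pm_{\underline p,r}$, $r=1,2$, be bosonic creation/annihilation operators on the corresponding Fock space with $[c^-_{\underline p,r},c^+_{\underline p',r'}]=L\mathcal A_\Lambda\,\delta_{\underline p,\underline p'}\delta_{r,r'}$. Let $M>1$, $a_0>0$, $h^*\in\mathbb Z$ with $h^*<0$, let $\chi$ be a smooth function with $\chi(s)=1$ for $s\le a_0$ and $\chi(s)=0$ for $s\ge a_0M$, and suppose that $\chi_{[h^*,0]}(s):=\chi(s)-\chi(M^{-h^*}s)\ge 0$ for $s\ge0$. Let $\underline\varepsilon_{\underline p,r}\in\mathbb C^3$ satisfy $\underline\varepsilon^*_{\underline p,r}\cdot\underline\varepsilon_{\underline p,r'}=\delta_{r,r'}$ and $\underline\varepsilon_{\underline p,r}\cdot\underline p=0$. Set $$\underline A_{\underline y}=\frac1{\mathcal A_\Lambda L}\sum_{\underline p,r}\sqrt{\frac{\chi_{[h^*,0]}(|\underline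 p|)}{2|\underline p|}}\Big(\underline\varepsilon_{\underline p,r}c^-_{\underline p,r}e^{-i\underline p\cdot\underline y}+\underline\varepsilon^*_{\underline p,r}c^+_{\underline p,r}e^{i\underline p\cdot\underline y}\Big),\qquad A_{(\vec x,i)}=\int_0^1ds\,\vec\delta_i\cdot\vec A_{(\vec x+s\vec\delta_i,0)},$$ $$\varphi(\underline y)=\frac1{\mathcal A_\Lambda L}\sum_{\underline p}\frac{\chi_{[h^*,0]}(|\underline p|)}{|\underline p|^2}e^{-i\underline p\cdot\underline y},$$ and, for the charge $e\in\mathbb R$, $$\rho^{(E_+)}_{\vec x,i}=\sum_{\sigma=\uparrow,\downarrow}\Big(a^+_{\vec x,\sigma}b^-_{\vec x+\vec\delta_i,\sigma}e^{ieA_{(\vec x,i)}}+b^+_{\vec x+\vec\delta_i,\sigma}a^-_{\vec x,\sigma}e^{-ieA_{(\vec x,i)}}\Big),\qquad \hat\rho^{(E_+)}_{\vec k,i}=\sum_{\vec x\in\Lambda}e^{i\vec k\cdot\vec x}\rho^{(E_+)}_{\vec x,i}.$$ For a distortion $\phi=(\phi_{\vec x,i})_{\vec x\in\Lambda,\,i=1,2,3}$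 of real numbers and hopping parameter $t\in\mathbb R$, let $$\mathcal H_\Lambda(\{\phi\})=-\sum_{\vec x\in\Lambda}\sum_{i=1}^3(t+\phi_{\vec x,i})\rho^{(E_+)}_{\vec x,i}+\frac{e^2}2\sum_{\vec x,\vec y\in\Lambda_A\cup\Lambda_B}(n_{\vec x}-1)\varphi(\vec x-\vec y,0)(n_{\vec y}-1)+\frac1{L\mathcal A_\Lambda}\sum_{\underline p,r}|\underline p|\,c^+_{\underline p,r}c^-_{\underline p,r},$$ and, for $\beta>0$, let $\langle X\rangle^{\phi}_{\beta,L}=\mathrm{Tr}\big(e^{-\beta\mathcal H_\Lambda(\{\phi\})}X\big)\big/\mathrm{Tr}\,e^{-\beta\mathcal H_\Lambda(\{\phi\})}$. For $\phi_0,\Delta_0\in\mathbb R$ and $j_0\in\{1,2,3\}$ consider the Kekulé distortion $$\phi^{*,(j_0)}_{\vec x,i}=\phi_0+\tfrac23\Delta_0\cos\big(\vec p_F^{\,+}\cdot(\vec\delta_i-\vec\delta_{j_0}-\vec x)\big),$$ and write $\langle\cdot\rangle^{(j_0)}_{\beta,L}$ for the average in presence of $\phi^{*,(j_0)}$. Let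 $g\in\mathbb R$ and $\kappa>0$. Then the gap equation $$\phi^{*,(j_0)}_{\vec x,i}=\frac{g^2}{\kappa}\big\langle\rho^{(E_+)}_{\vec x,i}\big\rangle^{(j_0)}_{\beta,L}\qquad\text{for all }\vec x\in\Lambda,\ i=1,2,3,$$ holds if and only if the two equations $$\phi_0=\frac{g^2}{\kappa}\frac1{|\Lambda|}\big\langle\hat\rho^{(E_+)}_{\vec 0,1}\big\rangle^{(1)}_{\beta,L},\qquad \frac{\Delta_0}{3}=\frac{g^2}{\kappa}\frac1{|\Lambda|}\big\langle\hat\rho^{(E_+)}_{\vec p_F^{\,+},1}\big\rangle^{(1)}_{\beta,L}$$ hold. -/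

import Mathlib

open scoped BigOperators ContDiff

noncomputable section

namespace Honeycomb

/-! ### Geometry of the periodic honeycomb lattice -/

/-- Basis vectors of the triangular Bravais lattice. -/
def a₁ : Fin 2 → ℝ := ![3 / 2, √3 / 2]

def a₂ : Fin 2 → ℝ := ![3 / 2, -(√3 / 2)]

/-- Basis vectors of the dual lattice. -/
def b₁ : Fin 2 → ℝ := ![2 * Real.pi / 3, 2 * Real.pi / 3 * √3]

def b₂ : Fin 2 → ℝ := ![2 * Real.pi / 3, -(2 * Real.pi / 3 * √3)]

/-- The nearest neighbour vectors; the indices `0, 1, 2` stand for `1, 2, 3`. -/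
def δ : Fin 3 → (Fin 2 → ℝ) :=
  ![![1, 0], ![-(1 / 2), √3 / 2], ![-(1 / 2), -(√3 / 2)]]

/-- The Fermi point `p_F^+`. -/
def pF : Fin 2 → ℝ := ![2 * Real.pi / 3, 2 * Real.pi / (3 * √3)]

/-- The periodic triangular lattice `Λ = 𝔹 / L𝔹`: the pair `(m, n)` is the class of
`m a₁ + n a₂`. -/
abbrev Cell (L : ℕ) : Type := ZMod L × ZMod L

/-- The representative of a lattice point in the fundamental domain. -/
def cellPos {L : ℕ} (x : Cell L) : Fin 2 → ℝ :=
  (x.1.val : ℝ) • a₁ + (x.2.val : ℝ) • a₂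

/-- Sites of the honeycomb lattice: `(0, x)` is the `A` site `x`, `(1, x)` is the `B` site
`x + δ₁`. -/
abbrev Site (L : ℕ) : Type := Fin 2 × Cell L

def sitePos {L : ℕ} (s : Site L) : Fin 2 → ℝ :=
  if s.1 = 0 then cellPos s.2 else cellPos s.2 + δ 0

/-- The cell `y` with `x + δ_i = y + δ₁`; here `δ₂ - δ₁ = -a₂` and `δ₃ - δ₁ = -a₁`. -/
def neighbourCell {L : ℕ} (x : Cell L) (i : Fin 3) : Cell L :=
  (![x, (x.1, x.2 - 1), (x.1 - 1, x.2)] : Fin 3 → Cell L) i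

/-- The area of `Λ`. -/
def area (L : ℕ) : ℝ := (L : ℝ) ^ 2 * (3 * √3 / 2)

/-! ### Fermionic operators -/

section Fermions

variable {F : Type} [Fintype F] [DecidableEq F]

/-- The fermionic annihilation operator of the one-particle state `f` in the occupation number
basis (indexed by the finite set of occupied one-particle states), with Jordan-Wigner signs
with respect to an enumeration of the one-particle states. -/
def fermiAnn (f : F) : Matrix (Finset F) (Finset F) ℂ := fun S S' =>
  if f ∈ S' ∧ S = S'.erase f then
    (-1) ^ (S'.filter (fun g => Fintype.equivFin F g < Fintype.equivFin F f)).card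
  else 0

def fermiCre (f : F) : Matrix (Finset F) (Finset F) ℂ := (fermiAnn f).conjTranspose

end Fermions

/-- One-particle states of the electrons: a site and a spin. -/
abbrev Orbital (L : ℕ) : Type := Site L × Fin 2

/-- Occupation number configurations of the electrons. -/
abbrev FConf (L : ℕ) : Type := Finset (Orbital L)

/-! ### Photons -/

/-- Labels of the nonzero momenta of the photons (the mode of zero momentum has zero energy and
is not coupled to the electrons). -/
abbrev Momentum : Type := {n : ℤ × ℤ × ℤ // n ≠ 0}

/-- The planar part `(n₁/L) b₁ + (n₂/L) b₂` of a momentum. -/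
def planar (L : ℕ) (n : Momentum) : Fin 2 → ℝ :=
  ((n.1.1 : ℝ) / L) • b₁ + ((n.1.2.1 : ℝ) / L) • b₂

/-- The three-dimensional momentum, with third component `2π n₃ / L`. -/
def momentum (L : ℕ) (n : Momentum) : Fin 3 → ℝ :=
  ![planar L n 0, planar L n 1, 2 * Real.pi * (n.1.2.2 : ℝ) / L]

/-- The modulus of the three-dimensional momentum. -/
def absMomentum (L : ℕ) (n : Momentum) : ℝ := √(momentum L n ⬝ᵥ momentum L n)

/-- Photon modes: a momentum and a polarization label. -/
abbrev Mode : Type := Momentum × Fin 2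

/-- Occupation numbers of the photon modes. -/
abbrev Occ : Type := Mode →₀ ℕ

/-- The photon Fock space, in the occupation number representation. -/
abbrev PhotonSpace : Type := lp (fun _ : Occ => ℂ) 2

/-- The finite combinations of occupation number states. -/
abbrev PhotonCore : Type := Occ →₀ ℂ

/-- The inclusion of the finite combinations of occupation number states in Fock space. -/
def toFock : PhotonCore →ₗ[ℂ] PhotonSpace :=
  Finsupp.linearCombination ℂ (fun n : Occ => lp.single 2 n (1 : ℂ))

/-- The annihilation operator `c⁻`, normalized by `[c⁻, c⁺] = L 𝒜_Λ`. -/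
def photonAnn (L : ℕ) (m : Mode) : Module.End ℂ PhotonCore :=
  Finsupp.linearCombination ℂ (fun n : Occ =>
    Finsupp.single (n - Finsupp.single m 1) ((√(L * area L * (n m : ℝ)) : ℝ) : ℂ))

/-- The creation operator `c⁺`. -/
def photonCre (L : ℕ) (m : Mode) : Module.End ℂ PhotonCore :=
  Finsupp.linearCombination ℂ (fun n : Occ =>
    Finsupp.single (n + Finsupp.single m 1) ((√(L * area L * ((n m : ℝ) + 1)) : ℝ) : ℂ))

/-- `U` is the exponential `e^{iθA}`: it is a bounded operator given on the finite combinations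
of occupation number states by the exponential series. -/
def IsExpI (θ : ℝ) (A : Module.End ℂ PhotonCore) (U : PhotonSpace →L[ℂ] PhotonSpace) : Prop :=
  ∀ v : PhotonCore,
    HasSum (fun k : ℕ => ((Complex.I * θ) ^ k / (k.factorial : ℂ)) • toFock ((A ^ k) v))
      (U (toFock v))

open Classical in
/-- The operator `e^{iθA}`. It is used for `A` a finite linear combination of photon operators of
the form `f c⁻ + f̄ c⁺`; then it exists (the finite combinations of occupation number states are
analytic vectors of the symmetric operator `A`), is unique by density, and is unitary. -/
def expI (θ : ℝ) (A : Module.End ℂ PhotonCore) : PhotonSpace →L[ℂ] PhotonSpace :=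
  if h : ∃ U, IsExpI θ A U then h.choose else 0

/-- The energy `∑ |p| n_{p,r}` of an occupation number state, that is, the eigenvalue of
`(L 𝒜_Λ)⁻¹ ∑ |p| c⁺ c⁻`. -/
def photonEnergy (L : ℕ) (n : Occ) : ℝ := n.sum (fun m k => (k : ℝ) * absMomentum L m.1)

/-! ### The model -/

/-- The parameters of the model on the lattice of side `L`: hopping `t`, charge `e`, cutoff
function `χ` with its constants `a₀`, `M` and infrared scale `hstar`, polarization vectors `ε`. -/
structure Model (L : ℕ) where
  t : ℝ
  e : ℝ
  M : ℝ
  a₀ : ℝ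
  hstar : ℤ
  χ : ℝ → ℝ
  ε : Momentum → Fin 2 → (Fin 3 → ℂ)
  one_lt_M : 1 < M
  a₀_pos : 0 < a₀
  hstar_neg : hstar < 0
  χ_smooth : ContDiff ℝ ∞ χ
  χ_one : ∀ s, s ≤ a₀ → χ s = 1
  χ_zero : ∀ s, a₀ * M ≤ s → χ s = 0
  /-- Nonnegativity of `χ_{[h*,0]}`, of which the photon field contains the square root. -/
  χ_nonneg : ∀ s, 0 ≤ s → 0 ≤ χ s - χ (M ^ (-hstar) * s)
  ε_orthonormal : ∀ p r r', star (ε p r) ⬝ᵥ ε p r' = if r = r' then 1 else 0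
  ε_transverse : ∀ p r, ε p r ⬝ᵥ (fun k => (momentum L p k : ℂ)) = 0

namespace Model

variable {L : ℕ} (m : Model L)

/-- The cutoff `χ_{[h*,0]}(s) = χ(s) - χ(M^{-h*} s)`. -/
def cutoff (s : ℝ) : ℝ := m.χ s - m.χ (m.M ^ (-m.hstar) * s)

/-- The coefficient of `c⁻_{p,r}` in `A_{(x,i)} = ∫₀¹ ds δ_i · A_{(x + s δ_i, 0)}`. -/
def fieldCoeff (x : Cell L) (i : Fin 3) (p : Momentum) (r : Fin 2) : ℂ :=
  ((1 / (area L * L) * √(m.cutoff (absMomentum L p) / (2 * absMomentum L p)) : ℝ) : ℂ) *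
    ∫ s in (0 : ℝ)..1,
      ((δ i 0 : ℂ) * m.ε p r 0 + (δ i 1 : ℂ) * m.ε p r 1) *
        Complex.exp (-(Complex.I * ((planar L p ⬝ᵥ (cellPos x + s • δ i) : ℝ) : ℂ)))

/-- The integrated vector potential `A_{(x,i)}`; only finitely many momenta contribute. -/
def bondField (x : Cell L) (i : Fin 3) : Module.End ℂ PhotonCore :=
  ∑ᶠ p : Momentum, ∑ r : Fin 2,
    (m.fieldCoeff x i p r • photonAnn L (p, r) +
      star (m.fieldCoeff x i p r) • photonCre L (p, r))

/-- The regularized Coulomb potential `φ(y, 0)`; only finitely many momenta contribute. -/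
def coulomb (y : Fin 2 → ℝ) : ℂ :=
  ((1 / (area L * L) : ℝ) : ℂ) * ∑ᶠ p : Momentum,
    ((m.cutoff (absMomentum L p) / absMomentum L p ^ 2 : ℝ) : ℂ) *
      Complex.exp (-(Complex.I * ((planar L p ⬝ᵥ y : ℝ) : ℂ)))

end Model

/-- The Hilbert space (fermionic Fock space) ⊗ (photon Fock space). -/
abbrev Space (L : ℕ) : Type := PiLp 2 (fun _ : FConf L => PhotonSpace)

/-- Bounded operators on `Space L`, as matrices in the occupation numbers of the electrons with
entries the bounded operators on the photon Fock space. -/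
abbrev Obs (L : ℕ) : Type := Matrix (FConf L) (FConf L) (PhotonSpace →L[ℂ] PhotonSpace)

/-- The operator `X ⊗ U`. -/
def tensorOp {L : ℕ} (X : Matrix (FConf L) (FConf L) ℂ) (U : PhotonSpace →L[ℂ] PhotonSpace) :
    Obs L := X.map (fun z => z • U)

section Finite

variable {L : ℕ} [NeZero L]

/-- The action of a bounded operator on vectors. -/
def Obs.act (X : Obs L) : Space L →ₗ[ℂ] Space L where
  toFun ψ := WithLp.toLp 2 (fun S => ∑ S', X S S' (ψ S'))
  map_add' ψ ψ' := by
    ext1 S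
    simp [Finset.sum_add_distrib]
  map_smul' c ψ := by
    ext1 S
    simp [Finset.smul_sum]

/-- Annihilation and creation operators of the electrons at a site with given spin. -/
def ann (s : Site L) (σ : Fin 2) : Matrix (FConf L) (FConf L) ℂ := fermiAnn (s, σ)

def cre (s : Site L) (σ : Fin 2) : Matrix (FConf L) (FConf L) ℂ := fermiCre (s, σ)

/-- The density operator at a site. -/
def density (s : Site L) : Matrix (FConf L) (FConf L) ℂ := ∑ σ : Fin 2, cre s σ * ann s σ

namespace Model

variable (m : Model L)

/-- The bond operator `ρ^{(E₊)}_{x,i}`. -/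
def bondOp (x : Cell L) (i : Fin 3) : Obs L :=
  ∑ σ : Fin 2,
    (tensorOp (cre (0, x) σ * ann (1, neighbourCell x i) σ) (expI m.e (m.bondField x i)) +
      tensorOp (cre (1, neighbourCell x i) σ * ann (0, x) σ) (expI (-m.e) (m.bondField x i)))

/-- The Fourier transform `ρ̂^{(E₊)}_{k,i} = ∑_x e^{i k·x} ρ^{(E₊)}_{x,i}`. -/
def bondOpHat (k : Fin 2 → ℝ) (i : Fin 3) : Obs L :=
  ∑ x : Cell L, Complex.exp (Complex.I * ((k ⬝ᵥ cellPos x : ℝ) : ℂ)) • m.bondOp x i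

/-- The Coulomb energy
`(e²/2) ∑_{x,y ∈ Λ_A ∪ Λ_B} (n_x - 1) φ(x - y, 0) (n_y - 1)`. -/
def coulombEnergy : Matrix (FConf L) (FConf L) ℂ :=
  ((m.e ^ 2 / 2 : ℝ) : ℂ) • ∑ s : Site L, ∑ s' : Site L,
    m.coulomb (sitePos s - sitePos s') • ((density s - 1) * (density s' - 1))

/-- The bounded part of the Hamiltonian: the hopping term with hopping parameter
`t + φ_{x,i}` and the Coulomb energy. -/
def boundedPart (φ : Cell L → Fin 3 → ℝ) : Obs L :=
  -(∑ x : Cell L, ∑ i : Fin 3, ((m.t + φ x i : ℝ) : ℂ) • m.bondOp x i) +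
    tensorOp m.coulombEnergy (ContinuousLinearMap.id ℂ PhotonSpace)

end Model

variable (L) in
/-- The energy of the free photon field, a diagonal operator with its maximal domain. -/
def photonHamiltonian : Space L →ₗ.[ℂ] Space L where
  domain :=
    { carrier := {ψ | ∀ S, Memℓp (fun n : Occ => (photonEnergy L n : ℂ) * ψ S n) 2}
      add_mem' := by
        intro ψ ψ' h h' S
        convert (h S).add (h' S) using 1
        ext n
        simp [mul_add]
      zero_mem' := by
        intro S
        convert (zero_memℓp : Memℓp (0 : ∀ _ : Occ, ℂ) 2) using 1
        ext n
        simp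
      smul_mem' := by
        intro c ψ h S
        convert (h S).const_smul c using 1
        ext n
        simp [mul_left_comm] }
  toFun :=
    { toFun := fun ψ => WithLp.toLp 2 (fun S =>
        (⟨fun n : Occ => (photonEnergy L n : ℂ) * (ψ : Space L) S n, ψ.2 S⟩ : PhotonSpace))
      map_add' := by
        intro ψ ψ'
        ext S n
        simp [mul_add]
        rfl
      map_smul' := by
        intro c ψ
        ext S n
        simp [mul_left_comm] }

/-- The Hamiltonian `ℋ_Λ({φ})` in presence of the distortion `φ`, defined on the domain of the
free photon energy. -/
def Model.hamiltonian (m : Model L) (φ : Cell L → Fin 3 → ℝ) : Space L →ₗ.[ℂ] Space L where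
  domain := (photonHamiltonian L).domain
  toFun := (photonHamiltonian L).toFun +
    (m.boundedPart φ).act ∘ₗ (photonHamiltonian L).domain.subtype

end Finite

/-! ### Grand-canonical averages -/

section Gibbs

variable {V : Type} [NormedAddCommGroup V] [InnerProductSpace ℂ V]

/-- The eigenspace of the unbounded operator `H` for the real number `E`. -/
def eigenspace (H : V →ₗ.[ℂ] V) (E : ℝ) : Submodule ℂ V :=
  (LinearMap.ker (H.toFun - (E : ℂ) • H.domain.subtype)).map H.domain.subtype

open Classical in
/-- The trace of the compression of `X` to a finite-dimensional subspace. -/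
def traceOn (W : Submodule ℂ V) (X : V →ₗ[ℂ] V) : ℂ :=
  if h : FiniteDimensional ℂ W then
    haveI := h
    LinearMap.trace ℂ W (W.orthogonalProjectionOnto.toLinearMap ∘ₗ X ∘ₗ W.subtype)
  else 0

/-- `Tr (e^{-βH} X) = ∑_E e^{-βE} Tr (P_E X)`, with `P_E` the projection on the eigenspace of `E`.
It is used for `H` self-adjoint with compact resolvent (here: the free photon energy plus a
bounded symmetric operator), so that the eigenvectors of `H` span the space, the eigenspaces are
finite-dimensional, and this sum is the trace of `e^{-βH} X` in a basis of eigenvectors. -/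
def gibbsTrace (β : ℝ) (H : V →ₗ.[ℂ] V) (X : V →ₗ[ℂ] V) : ℂ :=
  ∑' E : ℝ, (Real.exp (-(β * E)) : ℂ) * traceOn (eigenspace H E) X

/-- The average `Tr (e^{-βH} X) / Tr e^{-βH}`. -/
def gibbsAverage (β : ℝ) (H : V →ₗ.[ℂ] V) (X : V →ₗ[ℂ] V) : ℂ :=
  gibbsTrace β H X / gibbsTrace β H LinearMap.id

end Gibbs

/-- The average `⟨X⟩^φ_{β,L}` in presence of the distortion `φ`. -/
def Model.average {L : ℕ} [NeZero L] (m : Model L) (β : ℝ) (φ : Cell L → Fin 3 → ℝ)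
    (X : Obs L) : ℂ :=
  gibbsAverage β (m.hamiltonian φ) X.act

/-- The Kekulé distortion `φ₀ + (2/3) Δ₀ cos(p_F^+ · (δ_i - δ_{j₀} - x))`. -/
def kekule {L : ℕ} (φ₀ Δ₀ : ℝ) (j₀ : Fin 3) (x : Cell L) (i : Fin 3) : ℝ :=
  φ₀ + 2 / 3 * Δ₀ * Real.cos (pF ⬝ᵥ (δ i - δ j₀ - cellPos x))

/-- The gap equation `φ_{x,i} = (g²/κ) ⟨ρ^{(E₊)}_{x,i}⟩^φ_{β,L}` for all `x`, `i`. -/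
def Model.GapEquation {L : ℕ} [NeZero L] (m : Model L) (β g κ : ℝ)
    (φ : Cell L → Fin 3 → ℝ) : Prop :=
  ∀ (x : Cell L) (i : Fin 3), (φ x i : ℂ) = (g ^ 2 / κ : ℝ) * m.average β φ (m.bondOp x i)

end Honeycomb

end

/-! Lattice translations and the rotation by 2π/3 about an A site are symmetries of the model: each
is implemented by a unitary that carries the Hamiltonian with one Kekulé distortion to the
Hamiltonian with another, and bond operators to bond operators. Since 3 divides `L`, the values
p_F⁺·a₁ = 4π/3 and p_F⁺·a₂ = 2π/3 make the distortion on the bond `(x, i)` a function of the class i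
− j − (x₁ − x₂) mod 3 alone (`kekule_eq`). Any bond can be translated to the origin and then rotated
into the first direction while the label `j` is adjusted so that the class is unchanged. So the
averages of all bond operators, for all labels, are values `f c` of a single function on `ZMod 3`
(`Model.exists_average_kekule_eq`), real because bond operators are symmetric.

The gap equation thus amounts to three real equations indexed by the class, whatever the label.
Fourier transform on `ZMod 3` turns them into one equation for the zero mode and one for the mode of
the standard character; the third mode is the conjugate of the second because `f` is real
(`kekule_values_iff_fourier`). These two modes are the averages of the Fourier transformed bond
operators, as every class contains a third of the cells (`sum_kekuleClass`).

The implementing unitary has two factors. On photons, occupation states are identified with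
polynomials, and a unitary change of modes becomes a linear substitution of variables
(`fockTransform`). On electrons, a permutation of sites acts by a signed permutation of
configurations, the sign counting inversions (`fermiAnn_map`). Polarizations are not assumed
rotation covariant, so the rotation includes a unitary 2×2 matrix at each momentum
(`exists_polarization_change`).

Taking the average inside the Fourier sum requires convergence of the series over energies
(`Model.average_sum_smul`). It follows from a Peierls type inequality comparing the weights of
eigenvectors with the free photon partition function (`Model.sum_exp_eigenvalues_le`). No spectral
theorem, nonvanishing of the partition function or existence of the exponentials is needed: the
unitaries transport default values as well. -/

noncomputable section

namespace Honeycomb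

/-! ### Gibbs traces: unitary covariance, linearity, reality, convergence. -/

section GibbsTrace

variable {V : Type} [NormedAddCommGroup V] [InnerProductSpace ℂ V]

theorem mem_eigenspace {H : V →ₗ.[ℂ] V} {E : ℝ} {v : V} :
    v ∈ eigenspace H E ↔ ∃ h : v ∈ H.domain, H ⟨v, h⟩ = (E : ℂ) • v := by
  simp only [eigenspace, Submodule.mem_map, LinearMap.mem_ker, LinearMap.sub_apply,
    LinearMap.smul_apply, Submodule.subtype_apply, sub_eq_zero]
  constructor
  · rintro ⟨w, hw, rfl⟩
    exact ⟨w.2, hw⟩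
  · rintro ⟨h, hv⟩
    exact ⟨⟨v, h⟩, hv, rfl⟩

theorem traceOn_eq_sum_inner {ι : Type*} [Fintype ι] {W : Submodule ℂ V}
    (b : OrthonormalBasis ι ℂ W) (X : V →ₗ[ℂ] V) :
    traceOn W X = ∑ i, inner ℂ (b i : V) (X (b i)) := by
  have h : FiniteDimensional ℂ W := b.toBasis.finiteDimensional_of_finite
  rw [traceOn, dif_pos h, LinearMap.trace_eq_sum_inner _ b]
  refine Finset.sum_congr rfl fun i _ => ?_
  simp only [LinearMap.comp_apply, Submodule.subtype_apply, ContinuousLinearMap.coe_coe]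
  exact Submodule.inner_orthogonalProjectionOnto_eq_of_mem_left _ _

theorem traceOn_map (U : V ≃ₗᵢ[ℂ] V) (W : Submodule ℂ V) {X X' : V →ₗ[ℂ] V}
    (h : ∀ v, U (X v) = X' (U v)) :
    traceOn (W.map (U.toLinearEquiv : V →ₗ[ℂ] V)) X' = traceOn W X := by
  by_cases hW : FiniteDimensional ℂ W
  · have b := stdOrthonormalBasis ℂ W
    rw [traceOn_eq_sum_inner b]
    refine (traceOn_eq_sum_inner (b.map (U.submoduleMap W)) X').trans ?_
    refine Finset.sum_congr rfl fun i _ => ?_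
    have : ((b.map (U.submoduleMap W)) i : V) = U (b i) := by simp
    rw [this, ← h, U.inner_map_map]
  · have hW' : ¬ FiniteDimensional ℂ (W.map (U.toLinearEquiv : V →ₗ[ℂ] V)) := by
      intro h'
      exact hW (LinearEquiv.finiteDimensional (U.toLinearEquiv.submoduleMap W).symm)
    rw [traceOn, traceOn, dif_neg hW, dif_neg hW']

theorem eigenspace_map (U : V ≃ₗᵢ[ℂ] V) {H H' : V →ₗ.[ℂ] V}
    (hdom : ∀ v, U v ∈ H'.domain ↔ v ∈ H.domain)
    (h : ∀ v (hv : v ∈ H.domain) (hv' : U v ∈ H'.domain), H' ⟨U v, hv'⟩ = U (H ⟨v, hv⟩))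
    (E : ℝ) : eigenspace H' E = (eigenspace H E).map (U.toLinearEquiv : V →ₗ[ℂ] V) := by
  ext w
  obtain ⟨v, rfl⟩ := U.surjective w
  have : U v ∈ (eigenspace H E).map (U.toLinearEquiv : V →ₗ[ℂ] V) ↔ v ∈ eigenspace H E :=
    ⟨fun ⟨_, h1, h2⟩ => U.injective h2 ▸ h1, fun h1 => ⟨v, h1, rfl⟩⟩
  rw [this, mem_eigenspace, mem_eigenspace]
  constructor
  · rintro ⟨h1, h2⟩
    refine ⟨(hdom v).1 h1, U.injective ?_⟩
    rw [← h v _ h1, h2, map_smul]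
  · rintro ⟨h1, h2⟩
    refine ⟨(hdom v).2 h1, ?_⟩
    rw [h v h1, h2, map_smul]

/-- The two series agree term by term, eigenspaces being mapped onto each other, so nothing about
convergence or completeness of eigenvectors is required. -/
theorem gibbsTrace_eq_of_intertwining (U : V ≃ₗᵢ[ℂ] V) {H H' : V →ₗ.[ℂ] V}
    (hdom : ∀ v, U v ∈ H'.domain ↔ v ∈ H.domain)
    (h : ∀ v (hv : v ∈ H.domain) (hv' : U v ∈ H'.domain), H' ⟨U v, hv'⟩ = U (H ⟨v, hv⟩))
    {X X' : V →ₗ[ℂ] V} (hX : ∀ v, U (X v) = X' (U v)) (β : ℝ) :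
    gibbsTrace β H' X' = gibbsTrace β H X := by
  simp only [gibbsTrace, eigenspace_map U hdom h, traceOn_map U _ hX]

theorem gibbsAverage_eq_of_intertwining (U : V ≃ₗᵢ[ℂ] V) {H H' : V →ₗ.[ℂ] V}
    (hdom : ∀ v, U v ∈ H'.domain ↔ v ∈ H.domain)
    (h : ∀ v (hv : v ∈ H.domain) (hv' : U v ∈ H'.domain), H' ⟨U v, hv'⟩ = U (H ⟨v, hv⟩))
    {X X' : V →ₗ[ℂ] V} (hX : ∀ v, U (X v) = X' (U v)) (β : ℝ) :
    gibbsAverage β H' X' = gibbsAverage β H X := by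
  rw [gibbsAverage, gibbsAverage, gibbsTrace_eq_of_intertwining U hdom h hX,
    gibbsTrace_eq_of_intertwining U hdom h (X := LinearMap.id) (X' := LinearMap.id)
      (fun _ => rfl)]

theorem traceOn_sum_smul {ι : Type*} (s : Finset ι) (W : Submodule ℂ V) (c : ι → ℂ)
    (X : ι → V →ₗ[ℂ] V) :
    traceOn W (∑ k ∈ s, c k • X k) = ∑ k ∈ s, c k * traceOn W (X k) := by
  by_cases hW : FiniteDimensional ℂ W
  · have b := stdOrthonormalBasis ℂ W
    simp only [traceOn_eq_sum_inner b, LinearMap.sum_apply, LinearMap.smul_apply, inner_sum,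
      inner_smul_right, Finset.mul_sum]
    exact Finset.sum_comm
  · simp [traceOn, dif_neg hW]

/-- Summability enters because `tsum` is additive only on summable families. The denominator may
vanish: division by it is linear anyway. -/
theorem gibbsAverage_sum_smul {ι : Type*} (s : Finset ι) {β : ℝ} {H : V →ₗ.[ℂ] V} (c : ι → ℂ)
    (X : ι → V →ₗ[ℂ] V)
    (hX : ∀ k ∈ s, Summable fun E : ℝ =>
      (Real.exp (-(β * E)) : ℂ) * traceOn (eigenspace H E) (X k)) :
    gibbsAverage β H (∑ k ∈ s, c k • X k) = ∑ k ∈ s, c k * gibbsAverage β H (X k) := by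
  have : gibbsTrace β H (∑ k ∈ s, c k • X k) = ∑ k ∈ s, c k * gibbsTrace β H (X k) := by
    simp only [gibbsTrace, traceOn_sum_smul, ← tsum_mul_left]
    rw [← Summable.tsum_finsetSum fun k hk => (hX k hk).mul_left (c k)]
    refine tsum_congr fun E => ?_
    rw [Finset.mul_sum]
    exact Finset.sum_congr rfl fun k _ => by ring
  rw [gibbsAverage, this, Finset.sum_div]
  exact Finset.sum_congr rfl fun k _ => by rw [gibbsAverage, mul_div_assoc]

theorem conj_traceOn {W : Submodule ℂ V} {X : V →ₗ[ℂ] V} (hX : X.IsSymmetric) :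
    (starRingEnd ℂ) (traceOn W X) = traceOn W X := by
  by_cases hW : FiniteDimensional ℂ W
  · have b := stdOrthonormalBasis ℂ W
    rw [traceOn_eq_sum_inner b, map_sum]
    refine Finset.sum_congr rfl fun i _ => ?_
    rw [inner_conj_symm, hX]
  · simp [traceOn, dif_neg hW]

theorem conj_gibbsAverage {β : ℝ} {H : V →ₗ.[ℂ] V} {X : V →ₗ[ℂ] V} (hX : X.IsSymmetric) :
    (starRingEnd ℂ) (gibbsAverage β H X) = gibbsAverage β H X := by
  have key : ∀ Y : V →ₗ[ℂ] V, Y.IsSymmetric →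
      (starRingEnd ℂ) (gibbsTrace β H Y) = gibbsTrace β H Y := by
    intro Y hY
    rw [gibbsTrace, Complex.conj_tsum]
    refine tsum_congr fun E => ?_
    rw [map_mul, conj_traceOn hY, Complex.conj_ofReal]
  rw [gibbsAverage, map_div₀, key X hX, key _ LinearMap.IsSymmetric.id]

/-- If the Gibbs weights of orthonormal families of eigenvectors have bounded sums, then the series
defining the Gibbs trace of a bounded operator converges. -/
theorem summable_gibbsTrace {β : ℝ} {H : V →ₗ.[ℂ] V} {X : V →ₗ[ℂ] V} {C K : ℝ}
    (horth : ∀ E E' : ℝ, E ≠ E' → eigenspace H E ⟂ eigenspace H E')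
    (hK : ∀ (ι : Type) [Fintype ι] (v : ι → V) (E : ι → ℝ), Orthonormal ℂ v →
      (∀ k, v k ∈ eigenspace H (E k)) → ∑ k, Real.exp (-(β * E k)) ≤ K)
    (hC : 0 ≤ C) (hX : ∀ v : V, ‖v‖ = 1 → ‖inner ℂ v (X v)‖ ≤ C) :
    Summable fun E : ℝ => (Real.exp (-(β * E)) : ℂ) * traceOn (eigenspace H E) X := by
  classical
  refine Summable.of_norm (summable_of_sum_le (c := C * K) (fun _ => norm_nonneg _) fun s => ?_)
  let D : ℝ → Prop := fun E => FiniteDimensional ℂ (eigenspace H E)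
  -- Energies with an infinite-dimensional eigenspace contribute the default value 0 of `traceOn`;
  -- dropping them leaves eigenspaces with finite orthonormal bases, whose union is an orthonormal
  -- family of eigenvectors.
  let s' := s.filter D
  have hs' : ∀ E : s', FiniteDimensional ℂ (eigenspace H (E : ℝ)) := fun E =>
    (Finset.mem_filter.1 E.2).2
  let b : ∀ E : s', OrthonormalBasis (Fin (Module.finrank ℂ (eigenspace H (E : ℝ)))) ℂ
      (eigenspace H (E : ℝ)) := fun E => stdOrthonormalBasis ℂ _
  let ι := Σ E : s', Fin (Module.finrank ℂ (eigenspace H (E : ℝ)))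
  have hv : Orthonormal ℂ (fun k : ι => (b k.1 k.2 : V)) := by
    rw [orthonormal_iff_ite]
    rintro ⟨E, i⟩ ⟨E', i'⟩
    by_cases h : E = E'
    · subst h
      have := orthonormal_iff_ite.1 (b E).orthonormal i i'
      have h2 : (⟨E, i⟩ : ι) = ⟨E, i'⟩ ↔ i = i' := by simp
      simp only [h2]
      exact this
    · have h1 : (⟨E, i⟩ : ι) ≠ ⟨E', i'⟩ := fun h' => h (congrArg Sigma.fst h')
      rw [if_neg h1]
      exact (horth E' E fun h' => h (Subtype.ext h'.symm)) (b E' i').2 _ (b E i).2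
  have hsum := hK ι _ (fun k => (k.1 : ℝ)) hv (fun k => (b k.1 k.2).2)
  calc ∑ E ∈ s, ‖(Real.exp (-(β * E)) : ℂ) * traceOn (eigenspace H E) X‖
      = ∑ E ∈ s', ‖(Real.exp (-(β * E)) : ℂ) * traceOn (eigenspace H E) X‖ := by
        symm
        refine Finset.sum_filter_of_ne fun E _ hne => ?_
        by_contra hD
        exact hne (by simp [traceOn, dif_neg (show ¬ FiniteDimensional ℂ _ from hD)])
    _ = ∑ E : s', ‖(Real.exp (-(β * E)) : ℂ) * traceOn (eigenspace H (E : ℝ)) X‖ :=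
        (Finset.sum_coe_sort s' _).symm
    _ ≤ ∑ E : s', ∑ _i : Fin (Module.finrank ℂ (eigenspace H (E : ℝ))),
          C * Real.exp (-(β * E)) := by
        refine Finset.sum_le_sum fun E _ => ?_
        rw [norm_mul, traceOn_eq_sum_inner (b E), Complex.norm_real, Real.norm_of_nonneg
          (Real.exp_nonneg _), ← Finset.mul_sum, Finset.sum_const, nsmul_eq_mul]
        have : ‖∑ i, inner ℂ (b E i : V) (X (b E i))‖
            ≤ ∑ _i : Fin (Module.finrank ℂ (eigenspace H (E : ℝ))), C :=
          norm_sum_le_of_le _ fun i _ => hX _ ((b E).orthonormal.1 i)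
        rw [Finset.sum_const, nsmul_eq_mul] at this
        nlinarith [Real.exp_nonneg (-(β * (E : ℝ)))]
    _ = C * ∑ k : ι, Real.exp (-(β * (k.1 : ℝ))) := by
        rw [Finset.mul_sum, Fintype.sum_sigma]
    _ ≤ C * K := mul_le_mul_of_nonneg_left hsum hC

end GibbsTrace

/-! ### Finiteness of the free photon partition function. -/

section PartitionFunction

/-- A finite set of occupation numbers lies in a box, where the sum factors into geometric sums.
Each factor is at most 1 + q/(1 − q) ≤ exp(q/(1 − r)), so the product is at most exp(∑ q/(1 − r)),
uniformly in the box. -/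
theorem summable_finsupp_prod_pow {ι : Type*} {q : ι → ℝ} {r : ℝ} (h0 : ∀ i, 0 ≤ q i)
    (hr : r < 1) (hq : ∀ i, q i ≤ r) (hs : Summable q) :
    Summable fun n : ι →₀ ℕ => n.prod fun i k => q i ^ k := by
  classical
  have hr' : 0 < 1 - r := sub_pos.2 hr
  have hgeom : ∀ i N, ∑ k ∈ Finset.range N, q i ^ k ≤ Real.exp (q i / (1 - r)) := by
    intro i N
    have hi : q i < 1 := (hq i).trans_lt hr
    have hi' : 0 < 1 - q i := sub_pos.2 hi
    calc ∑ k ∈ Finset.range N, q i ^ k ≤ (1 - q i)⁻¹ := by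
          rw [← tsum_geometric_of_lt_one (h0 i) hi]
          exact (summable_geometric_of_lt_one (h0 i) hi).sum_le_tsum _
            fun k _ => pow_nonneg (h0 i) k
      _ = q i / (1 - q i) + 1 := by field_simp; ring
      _ ≤ q i / (1 - r) + 1 := by
          have := div_le_div_of_nonneg_left (h0 i) hr' (sub_le_sub_left (hq i) 1)
          linarith
      _ ≤ _ := Real.add_one_le_exp _
  have hnn : ∀ n : ι →₀ ℕ, 0 ≤ n.prod fun i k => q i ^ k := fun n =>
    Finset.prod_nonneg fun i _ => pow_nonneg (h0 i) _
  refine summable_of_sum_le (c := Real.exp ((∑' i, q i) / (1 - r))) hnn fun T => ?_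
  let I : Finset ι := T.biUnion fun n => n.support
  let N : ℕ := (T.sup fun n => n.support.sup n) + 1
  have hT : T ⊆ I.finsupp fun _ => Finset.range N := by
    intro n hn
    rw [Finset.mem_finsupp_iff]
    refine ⟨Finset.subset_biUnion_of_mem (fun n : ι →₀ ℕ => n.support) hn, fun i _ => ?_⟩
    rw [Finset.mem_range, Nat.lt_succ_iff]
    by_cases hi : i ∈ n.support
    · exact (Finset.le_sup (f := n) hi).trans
        (Finset.le_sup (f := fun n : ι →₀ ℕ => n.support.sup n) hn)
    · rw [Finsupp.notMem_support_iff.1 hi]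
      exact Nat.zero_le _
  calc ∑ n ∈ T, (n.prod fun i k => q i ^ k)
      ≤ ∑ n ∈ I.finsupp fun _ => Finset.range N, (n.prod fun i k => q i ^ k) :=
        Finset.sum_le_sum_of_subset_of_nonneg hT fun n _ _ => hnn n
    _ = ∏ i ∈ I, ∑ k ∈ Finset.range N, q i ^ k := by
        rw [Finset.finsupp, Finset.sum_map, Finset.prod_sum]
        refine Finset.sum_congr rfl fun p _ => ?_
        change ((Finsupp.indicator I p).prod fun i k => q i ^ k) = _
        rw [Finsupp.prod_of_support_subset (s := I) _ (Finsupp.support_indicator_subset I _) _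
          (fun i _ => pow_zero _), ← Finset.prod_attach]
        refine Finset.prod_congr rfl fun i _ => ?_
        simp [Finsupp.indicator_of_mem i.2]
    _ ≤ ∏ i ∈ I, Real.exp (q i / (1 - r)) :=
        Finset.prod_le_prod (fun i _ => Finset.sum_nonneg fun k _ => pow_nonneg (h0 i) k)
          fun i _ => hgeom i N
    _ = Real.exp ((∑ i ∈ I, q i) / (1 - r)) := by rw [← Real.exp_sum, Finset.sum_div]
    _ ≤ _ := Real.exp_le_exp.2
        (div_le_div_of_nonneg_right (hs.sum_le_tsum _ fun i _ => h0 i) hr'.le)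

theorem momentum_dotProduct_self (L : ℕ) (n : Momentum) :
    momentum L n ⬝ᵥ momentum L n = (2 * Real.pi / (3 * L)) ^ 2 *
      (4 * (n.1.1 : ℝ) ^ 2 + 4 * (n.1.2.1 : ℝ) ^ 2 - 4 * n.1.1 * n.1.2.1
        + 9 * (n.1.2.2 : ℝ) ^ 2) := by
  have h3 : √3 ^ 2 = (3 : ℝ) := Real.sq_sqrt (by norm_num)
  simp only [momentum, planar, b₁, b₂, dotProduct, Fin.sum_univ_three, Matrix.cons_val_zero,
    Matrix.cons_val_one, Matrix.cons_val, Pi.add_apply, Pi.smul_apply, smul_eq_mul]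
  have h : ∀ a b : ℝ, (a / L * (2 * Real.pi / 3 * √3) + b / L * -(2 * Real.pi / 3 * √3))
      * (a / L * (2 * Real.pi / 3 * √3) + b / L * -(2 * Real.pi / 3 * √3))
      = 3 * (2 * Real.pi / (3 * L)) ^ 2 * (a - b) ^ 2 := by
    intro a b
    calc _ = √3 ^ 2 * (2 * Real.pi / (3 * L)) ^ 2 * (a - b) ^ 2 := by ring
      _ = _ := by rw [h3]
  rw [h]
  ring

/-- The planar quadratic form is positive definite, since a² + b² − ab ≥ (a² + b²)/2. Linear growth
in the labels makes the Boltzmann weights of the modes summable. -/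
theorem le_absMomentum {L : ℕ} [NeZero L] (n : Momentum) :
    Real.pi / (3 * L) * (|(n.1.1 : ℝ)| + |(n.1.2.1 : ℝ)| + |(n.1.2.2 : ℝ)|)
      ≤ absMomentum L n := by
  refine Real.le_sqrt_of_sq_le ?_
  rw [momentum_dotProduct_self, mul_pow]
  have e : (2 * Real.pi / (3 * L)) ^ 2 = (Real.pi / (3 * L)) ^ 2 * 4 := by ring
  rw [e, mul_assoc]
  refine mul_le_mul_of_nonneg_left ?_ (sq_nonneg _)
  have h1 := sq_abs (n.1.1 : ℝ)
  have h2 := sq_abs (n.1.2.1 : ℝ)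
  have h3 := sq_abs (n.1.2.2 : ℝ)
  nlinarith [sq_nonneg ((n.1.1 : ℝ) - n.1.2.1), sq_nonneg (|(n.1.1 : ℝ)| - |(n.1.2.1 : ℝ)|),
    sq_nonneg (|(n.1.1 : ℝ)| - |(n.1.2.2 : ℝ)|), sq_nonneg (|(n.1.2.1 : ℝ)| - |(n.1.2.2 : ℝ)|)]

/-- An infrared gap: a nonzero integer vector has a coordinate of modulus at least 1. It keeps all
single-mode weights below a common constant less than 1, so excluding the zero momentum matters
here. -/
theorem pi_div_le_absMomentum {L : ℕ} [NeZero L] (n : Momentum) :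
    Real.pi / (3 * L) ≤ absMomentum L n := by
  refine le_trans ?_ (le_absMomentum n)
  have hpos : 0 ≤ Real.pi / (3 * L) := by positivity
  refine le_mul_of_one_le_right hpos ?_
  have key : ∀ k : ℤ, k ≠ 0 → 1 ≤ |(k : ℝ)| := fun k hk => by
    exact_mod_cast Int.one_le_abs hk
  obtain ⟨⟨a, b, c⟩, hn⟩ := n
  have ha := abs_nonneg (a : ℝ)
  have hb := abs_nonneg (b : ℝ)
  have hc := abs_nonneg (c : ℝ)
  dsimp only
  by_cases h1 : a = 0
  · by_cases h2 : b = 0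
    · have h3 : c ≠ 0 := fun h3 => hn (by simp [h1, h2, h3])
      linarith [key c h3]
    · linarith [key b h2]
  · linarith [key a h1]

theorem absMomentum_pos {L : ℕ} [NeZero L] (n : Momentum) : 0 < absMomentum L n := by
  have : 0 < (L : ℝ) := Nat.cast_pos.2 (NeZero.pos L)
  exact lt_of_lt_of_le (by positivity) (pi_div_le_absMomentum n)

theorem summable_exp_neg_mul_abs_int {c : ℝ} (hc : 0 < c) :
    Summable fun k : ℤ => Real.exp (-(c * |(k : ℝ)|)) := by
  have h : Summable fun k : ℕ => Real.exp (-(c * (k : ℝ))) := by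
    refine (Real.summable_exp_nat_mul_iff (a := -c)).2 (neg_lt_zero.2 hc) |>.congr fun k => ?_
    congr 1
    ring
  refine Summable.of_nat_of_neg ?_ ?_
  · simpa using h
  · simpa using h

theorem summable_exp_neg_absMomentum {L : ℕ} [NeZero L] {β : ℝ} (hβ : 0 < β) :
    Summable fun n : Momentum => Real.exp (-(β * absMomentum L n)) := by
  have hL : 0 < (L : ℝ) := Nat.cast_pos.2 (NeZero.pos L)
  set c : ℝ := β * (Real.pi / (3 * L)) with hc
  have hc0 : 0 < c := by positivity
  have h1 := summable_exp_neg_mul_abs_int hc0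
  have h3 : Summable fun k : ℤ × ℤ × ℤ => Real.exp (-(c * |(k.1 : ℝ)|)) *
      (Real.exp (-(c * |(k.2.1 : ℝ)|)) * Real.exp (-(c * |(k.2.2 : ℝ)|))) :=
    h1.mul_of_nonneg (h1.mul_of_nonneg h1 (fun _ => Real.exp_nonneg _)
      (fun _ => Real.exp_nonneg _)) (fun _ => Real.exp_nonneg _)
      (fun _ => mul_nonneg (Real.exp_nonneg _) (Real.exp_nonneg _))
  refine Summable.of_nonneg_of_le (fun _ => Real.exp_nonneg _) (fun n => ?_)
    (h3.comp_injective (Subtype.val_injective (p := fun n : ℤ × ℤ × ℤ => n ≠ 0)))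
  simp only [Function.comp_apply]
  rw [← Real.exp_add, ← Real.exp_add]
  refine Real.exp_le_exp.2 ?_
  have := mul_le_mul_of_nonneg_left (le_absMomentum (L := L) n) hβ.le
  rw [← mul_assoc, ← hc] at this
  linarith

theorem summable_exp_neg_photonEnergy (L : ℕ) [NeZero L] {β : ℝ} (hβ : 0 < β) :
    Summable fun n : Occ => Real.exp (-(β * photonEnergy L n)) := by
  have hL : 0 < (L : ℝ) := Nat.cast_pos.2 (NeZero.pos L)
  have hq : Summable fun m : Mode => Real.exp (-(β * absMomentum L m.1)) := by
    have := (summable_exp_neg_absMomentum (L := L) hβ).mul_of_nonneg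
      (g := fun _ : Fin 2 => (1 : ℝ)) (Summable.of_finite) (fun _ => Real.exp_nonneg _)
      (fun _ => zero_le_one)
    simpa using this
  refine (summable_finsupp_prod_pow (r := Real.exp (-(β * (Real.pi / (3 * L)))))
    (fun _ => Real.exp_nonneg _) ?_ ?_ hq).congr fun n => ?_
  · rw [Real.exp_lt_one_iff]
    have : 0 < β * (Real.pi / (3 * L)) := by positivity
    linarith
  · intro m
    refine Real.exp_le_exp.2 (neg_le_neg ?_)
    exact mul_le_mul_of_nonneg_left (pi_div_le_absMomentum m.1) hβ.le
  · rw [photonEnergy, Finsupp.sum, Finset.mul_sum, ← Finset.sum_neg_distrib, Real.exp_sum,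
      Finsupp.prod]
    refine Finset.prod_congr rfl fun m _ => ?_
    rw [← Real.exp_nat_mul]
    congr 1
    ring

end PartitionFunction

/-! ### Photon operators on finite combinations of occupation states. -/

section PhotonCoreOperators

theorem toFock_single (n : Occ) (c : ℂ) : toFock (Finsupp.single n c) = lp.single 2 n c := by
  rw [toFock, Finsupp.linearCombination_single, ← lp.single_smul, smul_eq_mul, mul_one]

theorem inner_toFock_single (n : Occ) (c : ℂ) (ψ : PhotonSpace) :
    inner ℂ (toFock (Finsupp.single n c)) ψ = (starRingEnd ℂ) c * ψ n := by
  rw [toFock_single, lp.inner_single_left]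
  simp [mul_comm]

theorem toFock_apply (f : PhotonCore) (n : Occ) : toFock f n = f n := by
  induction f using Finsupp.induction_linear with
  | zero => simp
  | add f g hf hg => simp [hf, hg]
  | single k c =>
    rw [toFock_single]
    by_cases h : k = n
    · subst h; simp
    · rw [Finsupp.single_eq_of_ne (Ne.symm h), lp.single_apply_ne _ _ _ (Ne.symm h)]

theorem eq_of_inner_toFock {ψ ψ' : PhotonSpace}
    (h : ∀ f : PhotonCore, inner ℂ (toFock f) ψ = inner ℂ (toFock f) ψ') : ψ = ψ' := by
  ext n
  simpa [inner_toFock_single] using h (Finsupp.single n 1)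

theorem ext_of_toFock {U U' : PhotonSpace →L[ℂ] PhotonSpace}
    (h : ∀ f : PhotonCore, U (toFock f) = U' (toFock f)) : U = U' := by
  ext1 ψ
  have hs := lp.hasSum_single (p := 2) (by norm_num) ψ
  refine (hs.mapL U).unique ?_
  convert hs.mapL U' using 2 with n
  simpa only [toFock_single] using h (Finsupp.single n (ψ n))

theorem photonCre_single (L : ℕ) (m : Mode) (n : Occ) (c : ℂ) :
    photonCre L m (Finsupp.single n c) = Finsupp.single (n + Finsupp.single m 1)
      (c * ((√(L * area L * ((n m : ℝ) + 1)) : ℝ) : ℂ)) := by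
  rw [photonCre, Finsupp.linearCombination_single, Finsupp.smul_single, smul_eq_mul]

theorem photonAnn_single (L : ℕ) (m : Mode) (n : Occ) (c : ℂ) :
    photonAnn L m (Finsupp.single n c) = Finsupp.single (n - Finsupp.single m 1)
      (c * ((√(L * area L * (n m : ℝ)) : ℝ) : ℂ)) := by
  rw [photonAnn, Finsupp.linearCombination_single, Finsupp.smul_single, smul_eq_mul]

theorem exists_add_single_of_ne_zero {n : Occ} {m : Mode} (h : n m ≠ 0) :
    ∃ k : Occ, n = k + Finsupp.single m 1 :=
  ⟨n - Finsupp.single m 1, (tsub_add_cancel_of_le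
    (Finsupp.single_le_iff.2 (Nat.one_le_iff_ne_zero.2 h))).symm⟩

theorem inner_photonCre (L : ℕ) (m : Mode) (f g : PhotonCore) :
    inner ℂ (toFock (photonCre L m f)) (toFock g) =
      inner ℂ (toFock f) (toFock (photonAnn L m g)) := by
  induction f using Finsupp.induction_linear with
  | zero => simp
  | add f f' hf hf' => simp only [map_add, inner_add_left, hf, hf']
  | single n c =>
    induction g using Finsupp.induction_linear with
    | zero => simp
    | add g g' hg hg' => simp only [map_add, inner_add_right, hg, hg']
    | single k d =>
      rw [photonCre_single, photonAnn_single, inner_toFock_single, inner_toFock_single,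
        toFock_apply, toFock_apply]
      by_cases hk : k m = 0
      · have : k ≠ n + Finsupp.single m 1 := by
          rintro rfl
          simp at hk
        rw [Finsupp.single_eq_of_ne (Ne.symm this)]
        simp [hk]
      · obtain ⟨k, rfl⟩ := exists_add_single_of_ne_zero hk
        rw [add_tsub_cancel_right]
        by_cases hn : k = n
        · subst hn
          simp
          ring
        · rw [Finsupp.single_eq_of_ne (Ne.symm hn), Finsupp.single_eq_of_ne]
          · simp
          · exact fun h => hn (add_right_cancel h).symm

theorem inner_photonAnn (L : ℕ) (m : Mode) (f g : PhotonCore) :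
    inner ℂ (toFock (photonAnn L m f)) (toFock g) =
      inner ℂ (toFock f) (toFock (photonCre L m g)) := by
  rw [← inner_conj_symm, ← inner_photonCre, inner_conj_symm]

/-- Symmetric operators on the finite combinations of occupation number states. -/
def IsCoreSymmetric (A : Module.End ℂ PhotonCore) : Prop :=
  ∀ f g, inner ℂ (toFock (A f)) (toFock g) = inner ℂ (toFock f) (toFock (A g))

theorem isCoreSymmetric_zero : IsCoreSymmetric 0 := fun f g => by simp

theorem IsCoreSymmetric.add {A B : Module.End ℂ PhotonCore} (hA : IsCoreSymmetric A)
    (hB : IsCoreSymmetric B) : IsCoreSymmetric (A + B) := fun f g => by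
  simp only [LinearMap.add_apply, map_add, inner_add_left, inner_add_right, hA f g, hB f g]

theorem isCoreSymmetric_smul_photonAnn_add (L : ℕ) (m : Mode) (c : ℂ) :
    IsCoreSymmetric (c • photonAnn L m + star c • photonCre L m) := fun f g => by
  simp only [LinearMap.add_apply, LinearMap.smul_apply, map_add, map_smul, inner_add_left,
    inner_add_right, inner_smul_left, inner_smul_right, inner_photonAnn, inner_photonCre]
  simp only [starRingEnd_apply, star_star]
  exact add_comm _ _

theorem IsCoreSymmetric.pow {A : Module.End ℂ PhotonCore} (hA : IsCoreSymmetric A) (k : ℕ) :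
    IsCoreSymmetric (A ^ k) := by
  induction k with
  | zero => exact fun f g => by simp
  | succ k ih =>
    intro f g
    rw [pow_succ, Module.End.mul_apply, ih, hA, ← Module.End.mul_apply, ← pow_succ', pow_succ]

/-- Induction over the `finsum` avoids checking that only finitely many momenta contribute. -/
theorem Model.isCoreSymmetric_bondField {L : ℕ} (m : Model L) (x : Cell L) (i : Fin 3) :
    IsCoreSymmetric (m.bondField x i) := by
  refine finsum_induction (p := IsCoreSymmetric) isCoreSymmetric_zero
    (fun _ _ hA hB => hA.add hB) fun p => ?_
  rw [Fin.sum_univ_two]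
  exact (isCoreSymmetric_smul_photonAnn_add _ _ _).add (isCoreSymmetric_smul_photonAnn_add _ _ _)

end PhotonCoreOperators

/-! ### Exponentials of the photon field: adjoints and conjugation. -/

section Exponentials

theorem IsExpI.unique {θ : ℝ} {A : Module.End ℂ PhotonCore} {U U' : PhotonSpace →L[ℂ] PhotonSpace}
    (h : IsExpI θ A U) (h' : IsExpI θ A U') : U = U' :=
  ext_of_toFock fun f => (h f).unique (h' f)

theorem IsExpI.expI_eq {θ : ℝ} {A : Module.End ℂ PhotonCore} {U : PhotonSpace →L[ℂ] PhotonSpace}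
    (h : IsExpI θ A U) : expI θ A = U := by
  have hex : ∃ U, IsExpI θ A U := ⟨U, h⟩
  rw [expI, dif_pos hex]
  exact hex.choose_spec.unique h

theorem IsExpI.adjoint {θ : ℝ} {A : Module.End ℂ PhotonCore}
    {U : PhotonSpace →L[ℂ] PhotonSpace} (hA : IsCoreSymmetric A) (h : IsExpI θ A U) :
    IsExpI (-θ) A (ContinuousLinearMap.adjoint U) := by
  intro v
  -- The series at −θ is twice the even part of the series at θ minus the whole; the even part
  -- converges because summability is unconditional.
  have hs : Summable fun k : ℕ =>
      ((Complex.I * (-θ : ℝ)) ^ k / (k.factorial : ℂ)) • toFock ((A ^ k) v) := by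
    have h1 := (h v).summable
    have h2 := (h1.indicator {k | Even k}).const_smul (2 : ℂ)
    refine (h2.sub h1).congr fun k => ?_
    have e : (Complex.I * ((-θ : ℝ) : ℂ)) = -1 * (Complex.I * θ) := by push_cast; ring
    rw [e, mul_pow (-1 : ℂ)]
    by_cases hk : Even k
    · rw [Set.indicator_of_mem (by exact hk), hk.neg_one_pow, two_smul, one_mul]
      abel
    · rw [Set.indicator_of_notMem (by exact hk), (Nat.not_even_iff_odd.1 hk).neg_one_pow,
        smul_zero, zero_sub, ← neg_smul]
      congr 1
      ring
  convert hs.hasSum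
  refine eq_of_inner_toFock fun w => ?_
  rw [ContinuousLinearMap.adjoint_inner_right]
  have h1 := (hs.hasSum.mapL (innerSL ℂ (toFock w)))
  simp only [innerSL_apply_apply] at h1
  have h2 := (((h w).mapL (innerSL ℂ (toFock v))).star)
  simp only [innerSL_apply_apply] at h2
  have e : inner ℂ (U (toFock w)) (toFock v) = star (inner ℂ (toFock v) (U (toFock w))) := by
    rw [← inner_conj_symm]; rfl
  rw [e]
  refine h2.unique ?_
  convert h1 using 1
  funext k
  rw [inner_smul_right, inner_smul_right, ← hA.pow k w v, star_mul', ← starRingEnd_apply (inner ..),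
    inner_conj_symm, ← starRingEnd_apply]
  simp

/-- Exponentials at θ and −θ exist together, so if neither exists both sides are the default 0. The
same device in `expI_conj` removes any need to prove existence. -/
theorem expI_neg {θ : ℝ} {A : Module.End ℂ PhotonCore} (hA : IsCoreSymmetric A) :
    expI (-θ) A = ContinuousLinearMap.adjoint (expI θ A) := by
  by_cases h : ∃ U, IsExpI θ A U
  · obtain ⟨U, hU⟩ := h
    rw [hU.expI_eq, (hU.adjoint hA).expI_eq]
  · have h' : ¬ ∃ U, IsExpI (-θ) A U := by
      rintro ⟨U, hU⟩
      exact h ⟨_, by simpa using hU.adjoint hA⟩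
    rw [expI, expI, dif_neg h, dif_neg h', map_zero]

theorem IsExpI.conj {θ : ℝ} {A A' : Module.End ℂ PhotonCore}
    {U : PhotonSpace →L[ℂ] PhotonSpace} (G : PhotonSpace ≃ₗᵢ[ℂ] PhotonSpace)
    (Gc : PhotonCore ≃ₗ[ℂ] PhotonCore) (hG : ∀ f, G (toFock f) = toFock (Gc f))
    (hA : ∀ f, Gc (A f) = A' (Gc f)) (h : IsExpI θ A U) :
    IsExpI θ A' ((G : PhotonSpace →L[ℂ] PhotonSpace) ∘L U ∘L
      (G.symm : PhotonSpace →L[ℂ] PhotonSpace)) := by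
  have hpow : ∀ k f, Gc ((A ^ k) f) = (A' ^ k) (Gc f) := by
    intro k
    induction k with
    | zero => intro f; simp
    | succ k ih => intro f; rw [pow_succ, Module.End.mul_apply, ih, hA, pow_succ]; rfl
  intro v
  obtain ⟨w, rfl⟩ := Gc.surjective v
  have e : G.symm (toFock (Gc w)) = toFock w := by rw [← hG, G.symm_apply_apply]
  change HasSum _ (G (U (G.symm (toFock (Gc w)))))
  rw [e]
  have hs := (h w).mapL (G : PhotonSpace →L[ℂ] PhotonSpace)
  change HasSum _ (G (U (toFock w))) at hs
  convert hs using 1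
  funext k
  change _ = G _
  rw [map_smul, hG, hpow]

theorem expI_conj (θ : ℝ) {A A' : Module.End ℂ PhotonCore} (G : PhotonSpace ≃ₗᵢ[ℂ] PhotonSpace)
    (Gc : PhotonCore ≃ₗ[ℂ] PhotonCore) (hG : ∀ f, G (toFock f) = toFock (Gc f))
    (hA : ∀ f, Gc (A f) = A' (Gc f)) (ψ : PhotonSpace) :
    G (expI θ A ψ) = expI θ A' (G ψ) := by
  by_cases h : ∃ U, IsExpI θ A U
  · obtain ⟨U, hU⟩ := h
    rw [hU.expI_eq, (hU.conj G Gc hG hA).expI_eq]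
    simp
  · have h' : ¬ ∃ U, IsExpI θ A' U := by
      rintro ⟨U, hU⟩
      refine h ⟨_, hU.conj G.symm Gc.symm (fun f => ?_) (fun f => ?_)⟩
      · rw [G.symm_apply_eq, hG, Gc.apply_symm_apply]
      · rw [Gc.symm_apply_eq, hA, Gc.apply_symm_apply]
    rw [expI, expI, dif_neg h, dif_neg h']
    simp

end Exponentials

/-! ### The polynomial model of photon states. -/

section Polynomials

/-- The square root of the product of the factorials of the occupation numbers. -/
def sqrtFactorial (n : Occ) : ℝ := √(n.prod fun _ k => (k.factorial : ℝ))

theorem sqrtFactorial_pos (n : Occ) : 0 < sqrtFactorial n :=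
  Real.sqrt_pos.2 (Finset.prod_pos fun _ _ => Nat.cast_pos.2 (Nat.factorial_pos _))

theorem sqrtFactorial_add_single (n : Occ) (m : Mode) :
    sqrtFactorial (n + Finsupp.single m 1) = √((n m : ℝ) + 1) * sqrtFactorial n := by
  have h0 : ∀ i : Mode, ((Nat.factorial 0 : ℕ) : ℝ) = 1 := fun _ => by simp
  have he : (n + Finsupp.single m 1).erase m = n.erase m := by
    rw [Finsupp.erase_add, Finsupp.erase_single, add_zero]
  rw [sqrtFactorial, sqrtFactorial, ← Real.sqrt_mul (by positivity),
    ← Finsupp.mul_prod_erase' _ m _ h0, ← Finsupp.mul_prod_erase' n m _ h0, he]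
  congr 1
  simp only [Finsupp.add_apply, Finsupp.single_eq_same, Nat.factorial_succ]
  push_cast
  ring

/-- Finite combinations of occupation number states as polynomials in the creation operators
applied to the vacuum. -/
def toPoly : PhotonCore ≃ₗ[ℂ] MvPolynomial Mode ℂ :=
  ((MvPolynomial.basisMonomials Mode ℂ).isUnitSMul (w := fun n => ((sqrtFactorial n : ℂ))⁻¹)
    fun n => (inv_ne_zero (Complex.ofReal_ne_zero.2 (sqrtFactorial_pos n).ne')).isUnit).repr.symm

theorem toPoly_single (n : Occ) (c : ℂ) :
    toPoly (Finsupp.single n c) = MvPolynomial.monomial n (c * ((sqrtFactorial n : ℂ))⁻¹) := by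
  rw [toPoly, Module.Basis.repr_symm_single, Module.Basis.isUnitSMul_apply,
    MvPolynomial.coe_basisMonomials, MvPolynomial.smul_monomial, MvPolynomial.smul_monomial,
    smul_eq_mul, smul_eq_mul, mul_one]

variable (L : ℕ)

/-- With the state `n` represented by Xⁿ/√(n!), creation is multiplication by a variable and, in
`toPoly_photonAnn`, annihilation is a partial derivative. A change of modes is then an algebra map.
-/
theorem toPoly_photonCre (m : Mode) (f : PhotonCore) :
    toPoly (photonCre L m f) =
      ((√(L * area L) : ℝ) : ℂ) • (toPoly f * MvPolynomial.X m) := by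
  induction f using Finsupp.induction_linear with
  | zero => simp
  | add f g hf hg => simp only [map_add, hf, hg, add_mul, smul_add]
  | single n c =>
    have hL : 0 ≤ (L : ℝ) * area L := by unfold area; positivity
    have h1 : ((√((n m : ℝ) + 1) : ℝ) : ℂ) ≠ 0 :=
      Complex.ofReal_ne_zero.2 (Real.sqrt_pos.2 (by positivity)).ne'
    have h2 : ((sqrtFactorial n : ℝ) : ℂ) ≠ 0 :=
      Complex.ofReal_ne_zero.2 (sqrtFactorial_pos n).ne'
    rw [photonCre_single, toPoly_single, toPoly_single, MvPolynomial.X,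
      MvPolynomial.monomial_mul, MvPolynomial.smul_monomial, sqrtFactorial_add_single,
      Real.sqrt_mul hL]
    congr 1
    push_cast
    rw [smul_eq_mul]
    field_simp

theorem toPoly_photonAnn (m : Mode) (f : PhotonCore) :
    toPoly (photonAnn L m f) =
      ((√(L * area L) : ℝ) : ℂ) • MvPolynomial.pderiv m (toPoly f) := by
  induction f using Finsupp.induction_linear with
  | zero => simp
  | add f g hf hg => simp only [map_add, hf, hg, smul_add]
  | single n c =>
    have hL : 0 ≤ (L : ℝ) * area L := by unfold area; positivity
    rw [photonAnn_single, toPoly_single, toPoly_single, MvPolynomial.pderiv_monomial]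
    by_cases hn : n m = 0
    · simp [hn]
    · obtain ⟨k, rfl⟩ := exists_add_single_of_ne_zero hn
      have h2 : ((sqrtFactorial k : ℝ) : ℂ) ≠ 0 :=
        Complex.ofReal_ne_zero.2 (sqrtFactorial_pos k).ne'
      have h1 : ((√((k m : ℝ) + 1) : ℝ) : ℂ) ≠ 0 :=
        Complex.ofReal_ne_zero.2 (Real.sqrt_pos.2 (by positivity)).ne'
      have h3 : ((√((k m : ℝ) + 1) : ℝ) : ℂ) * ((√((k m : ℝ) + 1) : ℝ) : ℂ) = (k m : ℂ) + 1 := by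
        rw [← Complex.ofReal_mul, Real.mul_self_sqrt (by positivity)]
        push_cast
        rfl
      rw [MvPolynomial.smul_monomial, add_tsub_cancel_right, sqrtFactorial_add_single,
        Real.sqrt_mul hL]
      congr 1
      simp only [Finsupp.add_apply, Finsupp.single_eq_same]
      push_cast
      rw [smul_eq_mul, ← h3]
      field_simp

/-- The substitution `X_{p,r} ↦ ∑ a(p)_{r,r'} X_{σ p,r'}`. -/
def modeSubst (σ : Momentum ≃ Momentum) (a : Momentum → Matrix (Fin 2) (Fin 2) ℂ) :
    MvPolynomial Mode ℂ →ₐ[ℂ] MvPolynomial Mode ℂ :=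
  MvPolynomial.aeval fun m => ∑ r', a m.1 m.2 r' • MvPolynomial.X (σ m.1, r')

variable (σ : Momentum ≃ Momentum) (a : Momentum → Matrix (Fin 2) (Fin 2) ℂ)

theorem modeSubst_X (m : Mode) :
    modeSubst σ a (MvPolynomial.X m) = ∑ r', a m.1 m.2 r' • MvPolynomial.X (σ m.1, r') :=
  MvPolynomial.aeval_X _ _

theorem modeSubst_comp (σ' : Momentum ≃ Momentum) (a' : Momentum → Matrix (Fin 2) (Fin 2) ℂ)
    (hσ : ∀ p, σ' (σ p) = p) (ha : ∀ p, a p * a' (σ p) = 1) :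
    (modeSubst σ' a').comp (modeSubst σ a) = AlgHom.id ℂ _ := by
  refine MvPolynomial.algHom_ext fun m => ?_
  obtain ⟨p, r⟩ := m
  have h : ∀ r'', ∑ r', a p r r' * a' (σ p) r' r'' = if r = r'' then 1 else 0 := fun r'' => by
    rw [← Matrix.mul_apply, ha, Matrix.one_apply]
  simp only [AlgHom.comp_apply, modeSubst_X, map_sum, map_smul, hσ, Finset.smul_sum, smul_smul,
    AlgHom.id_apply]
  rw [Finset.sum_comm]
  simp only [← Finset.sum_smul, h]
  simp

/-- Second quantization, on polynomials, of a unitary transformation of the modes. -/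
def modeEquiv (ha : ∀ p, a p * (a p).conjTranspose = 1) :
    MvPolynomial Mode ℂ ≃ₐ[ℂ] MvPolynomial Mode ℂ :=
  AlgEquiv.ofAlgHom (modeSubst σ a)
    (modeSubst σ.symm fun q => (a (σ.symm q)).conjTranspose)
    (modeSubst_comp _ _ _ _ σ.apply_symm_apply fun q => mul_eq_one_comm.1 (ha _))
    (modeSubst_comp _ _ _ _ σ.symm_apply_apply fun p => by rw [σ.symm_apply_apply, ha])

/-- The chain rule for a linear substitution. Both sides obey the same Leibniz rule, so variables
suffice. -/
theorem pderiv_modeSubst (p : Momentum) (r' : Fin 2) (f : MvPolynomial Mode ℂ) :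
    MvPolynomial.pderiv (σ p, r') (modeSubst σ a f) =
      ∑ r, a p r r' • modeSubst σ a (MvPolynomial.pderiv (p, r) f) := by
  induction f using MvPolynomial.induction_on with
  | C c => simp [MvPolynomial.algebraMap_eq]
  | add f g hf hg => simp only [map_add, hf, hg, smul_add, Finset.sum_add_distrib]
  | mul_X f m hf =>
    obtain ⟨q, s⟩ := m
    have hX : MvPolynomial.pderiv (σ p, r') (modeSubst σ a (MvPolynomial.X (q, s))) =
        ∑ r, a p r r' • modeSubst σ a (MvPolynomial.pderiv (p, r) (MvPolynomial.X (q, s))) := by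
      rw [modeSubst_X]
      simp only [map_sum, Derivation.map_smul, MvPolynomial.pderiv_X, Pi.single_apply, Prod.mk.injEq,
        σ.injective.eq_iff]
      by_cases h : q = p
      · subst h
        simp [apply_ite (modeSubst σ a)]
      · simp [h]
    simp only [map_mul, Derivation.leibniz, map_add, smul_add, Finset.sum_add_distrib, hf, hX,
      smul_eq_mul, Finset.mul_sum, mul_smul_comm]

end Polynomials

/-! ### Second quantization of unitary changes of modes. -/

section ModeTransformations

variable (L : ℕ) (σ : Momentum ≃ Momentum) (a : Momentum → Matrix (Fin 2) (Fin 2) ℂ)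
  (ha : ∀ p, a p * (a p).conjTranspose = 1)

/-- Second quantization of a unitary transformation of the modes, on the finite combinations of
occupation number states. -/
def coreTransform : PhotonCore ≃ₗ[ℂ] PhotonCore :=
  (toPoly.trans (modeEquiv σ a ha).toLinearEquiv).trans toPoly.symm

theorem toPoly_coreTransform (f : PhotonCore) :
    toPoly (coreTransform σ a ha f) = modeSubst σ a (toPoly f) := by
  simp only [coreTransform, LinearEquiv.trans_apply, LinearEquiv.apply_symm_apply]
  rfl

theorem coreTransform_vacuum (c : ℂ) :
    coreTransform σ a ha (Finsupp.single 0 c) = Finsupp.single 0 c := by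
  apply toPoly.injective
  rw [toPoly_coreTransform, toPoly_single]
  exact (modeSubst σ a).commutes _

theorem coreTransform_photonCre (p : Momentum) (r : Fin 2) (f : PhotonCore) :
    coreTransform σ a ha (photonCre L (p, r) f) =
      ∑ r', a p r r' • photonCre L (σ p, r') (coreTransform σ a ha f) := by
  apply toPoly.injective
  simp only [toPoly_coreTransform, map_sum, map_smul, toPoly_photonCre, map_mul, modeSubst_X,
    Finset.mul_sum, Finset.smul_sum, mul_smul_comm]
  exact Finset.sum_congr rfl fun r' _ => smul_comm _ _ _

theorem photonAnn_coreTransform (p : Momentum) (r' : Fin 2) (f : PhotonCore) :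
    photonAnn L (σ p, r') (coreTransform σ a ha f) =
      ∑ r, a p r r' • coreTransform σ a ha (photonAnn L (p, r) f) := by
  apply toPoly.injective
  simp only [map_sum, map_smul, toPoly_photonAnn, toPoly_coreTransform, pderiv_modeSubst,
    Finset.smul_sum]
  exact Finset.sum_congr rfl fun r' _ => smul_comm _ _ _

/-- The preceding chain rule, inverted by unitarity of `a p`. -/
theorem coreTransform_photonAnn (p : Momentum) (r : Fin 2) (f : PhotonCore) :
    coreTransform σ a ha (photonAnn L (p, r) f) =
      ∑ r', star (a p r r') • photonAnn L (σ p, r') (coreTransform σ a ha f) := by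
  have h : ∀ s, ∑ r', star (a p r r') * a p s r' = if s = r then 1 else 0 := fun s => by
    rw [← Matrix.one_apply, ← ha p, Matrix.mul_apply]
    exact Finset.sum_congr rfl fun r' _ => mul_comm _ _
  simp only [photonAnn_coreTransform, Finset.smul_sum, smul_smul]
  rw [Finset.sum_comm]
  simp only [← Finset.sum_smul, h]
  simp

/-- The vacuum is cyclic for the creation operators: for `L ≠ 0` their matrix elements are nonzero
and can be divided out. -/
theorem photonCore_induction {L : ℕ} [NeZero L] {P : PhotonCore → Prop}
    (vacuum : ∀ c, P (Finsupp.single 0 c)) (add : ∀ f g, P f → P g → P (f + g))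
    (cre : ∀ m f, P f → P (photonCre L m f)) (f : PhotonCore) : P f := by
  have hL : 0 < (L : ℝ) * area L := by
    have : 0 < (L : ℝ) := Nat.cast_pos.2 (NeZero.pos L)
    unfold area
    positivity
  have step : ∀ (m : Mode) (k : Occ), (∀ c, P (Finsupp.single k c)) →
      ∀ c, P (Finsupp.single (k + Finsupp.single m 1) c) := by
    intro m k hk c
    have h1 : ((√(L * area L * ((k m : ℝ) + 1)) : ℝ) : ℂ) ≠ 0 :=
      Complex.ofReal_ne_zero.2 (Real.sqrt_pos.2 (by positivity)).ne'
    have := cre m _ (hk (c / ((√(L * area L * ((k m : ℝ) + 1)) : ℝ) : ℂ)))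
    rwa [photonCre_single, div_mul_cancel₀ _ h1] at this
  have key : ∀ n k : Occ, (∀ c, P (Finsupp.single k c)) → ∀ c, P (Finsupp.single (k + n) c) := by
    intro n
    induction n using Finsupp.induction_linear with
    | zero => intro k hk; simpa using hk
    | add n n' hn hn' => intro k hk; rw [← add_assoc]; exact hn' _ (hn k hk)
    | single m j =>
      induction j with
      | zero => intro k hk; simpa using hk
      | succ j ih =>
        intro k hk
        rw [Finsupp.single_add, ← add_assoc]
        exact step m _ (ih k hk)
  induction f using Finsupp.induction_linear with
  | zero => simpa using vacuum 0
  | add f g hf hg => exact add f g hf hg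
  | single n c => simpa using key n 0 vacuum c

/-- Creation operators on the left are moved to the right as annihilation operators, which transform
in the adjoint way. What remains is the vacuum component, and states in the range of a creation
operator have none. -/
theorem inner_coreTransform [NeZero L] (f g : PhotonCore) :
    inner ℂ (toFock (coreTransform σ a ha f)) (toFock (coreTransform σ a ha g)) =
      inner ℂ (toFock f) (toFock g) := by
  induction f using photonCore_induction (L := L) generalizing g with
  | vacuum c =>
    rw [coreTransform_vacuum, inner_toFock_single, inner_toFock_single, toFock_apply,
      toFock_apply]
    congr 1
    induction g using photonCore_induction (L := L) with
    | vacuum c => rw [coreTransform_vacuum]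
    | add f g hf hg => rw [map_add, Finsupp.add_apply, Finsupp.add_apply, hf, hg]
    | cre m g _ =>
      have h0 : ∀ (m : Mode) (g : PhotonCore), photonCre L m g 0 = 0 := by
        intro m g
        have := inner_photonAnn L m (Finsupp.single 0 1) g
        rw [photonAnn_single, inner_toFock_single, inner_toFock_single, toFock_apply] at this
        simpa [toFock_apply] using this.symm
      obtain ⟨p, r⟩ := m
      simp [coreTransform_photonCre, h0]
  | add f f' hf hf' => simp only [map_add, inner_add_left, hf, hf']
  | cre m f hf =>
    obtain ⟨p, r⟩ := m
    rw [inner_photonCre, ← hf, coreTransform_photonCre, coreTransform_photonAnn]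
    simp only [map_sum, map_smul, sum_inner, inner_sum, inner_smul_left, inner_smul_right,
      inner_photonCre]
    rfl

/-- The photon energy on the finite combinations of occupation number states. -/
def coreEnergy : Module.End ℂ PhotonCore :=
  Finsupp.linearCombination ℂ fun n => Finsupp.single n (photonEnergy L n : ℂ)

theorem coreEnergy_single (n : Occ) (c : ℂ) :
    coreEnergy L (Finsupp.single n c) = (photonEnergy L n : ℂ) • Finsupp.single n c := by
  rw [coreEnergy, Finsupp.linearCombination_single, Finsupp.smul_single, Finsupp.smul_single,
    smul_eq_mul, smul_eq_mul, mul_comm]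

theorem photonEnergy_add_single (n : Occ) (m : Mode) :
    photonEnergy L (n + Finsupp.single m 1) = photonEnergy L n + absMomentum L m.1 := by
  rw [photonEnergy, Finsupp.sum_add_index' (by simp) (by intros; push_cast; ring),
    Finsupp.sum_single_index (by simp), photonEnergy]
  simp

theorem coreEnergy_photonCre (m : Mode) (f : PhotonCore) :
    coreEnergy L (photonCre L m f) =
      photonCre L m (coreEnergy L f) + (absMomentum L m.1 : ℂ) • photonCre L m f := by
  induction f using Finsupp.induction_linear with
  | zero => simp
  | add f g hf hg => simp only [map_add, hf, hg, smul_add]; abel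
  | single n c =>
    rw [coreEnergy_single, map_smul, photonCre_single, coreEnergy_single,
      photonEnergy_add_single, ← add_smul]
    push_cast
    rfl

/-- The commutator of the energy with c⁺ is |p| c⁺, and the transformation mixes only modes with the
same |p|. -/
theorem coreEnergy_coreTransform [NeZero L] (hσ : ∀ p, absMomentum L (σ p) = absMomentum L p)
    (f : PhotonCore) :
    coreEnergy L (coreTransform σ a ha f) = coreTransform σ a ha (coreEnergy L f) := by
  induction f using photonCore_induction (L := L) with
  | vacuum c =>
    have : photonEnergy L 0 = 0 := by simp [photonEnergy]
    rw [coreTransform_vacuum, coreEnergy_single, this]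
    simp
  | add f g hf hg => simp only [map_add, hf, hg]
  | cre m f hf =>
    obtain ⟨p, r⟩ := m
    rw [coreEnergy_photonCre, map_add, map_smul, coreTransform_photonCre, coreTransform_photonCre,
      map_sum, Finset.smul_sum, ← Finset.sum_add_distrib]
    refine Finset.sum_congr rfl fun r' _ => ?_
    rw [map_smul, coreEnergy_photonCre, hf, hσ, smul_add, smul_comm (absMomentum L p : ℂ)]

theorem orthonormal_coreTransform [NeZero L] :
    Orthonormal ℂ fun n : Occ => toFock (coreTransform σ a ha (Finsupp.single n 1)) := by
  rw [orthonormal_iff_ite]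
  intro n k
  rw [inner_coreTransform L, inner_toFock_single, toFock_apply, map_one, one_mul]
  by_cases h : n = k
  · subst h; simp
  · rw [if_neg h, Finsupp.single_eq_of_ne h]

theorem span_coreTransform_orthogonal :
    (Submodule.span ℂ (Set.range fun n : Occ =>
      toFock (coreTransform σ a ha (Finsupp.single n 1))))ᗮ = ⊥ := by
  rw [Submodule.eq_bot_iff]
  intro ψ hψ
  have h : ∀ f, inner ℂ (toFock (coreTransform σ a ha f)) ψ = 0 := by
    intro f
    induction f using Finsupp.induction_linear with
    | zero => simp
    | add f g hf hg => simp only [map_add, inner_add_left, hf, hg, add_zero]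
    | single n c =>
      rw [← mul_one c, ← smul_eq_mul, ← Finsupp.smul_single, map_smul, map_smul, inner_smul_left,
        hψ _ (Submodule.subset_span ⟨n, rfl⟩), mul_zero]
  refine eq_of_inner_toFock fun f => ?_
  rw [inner_zero_right, ← (coreTransform σ a ha).apply_symm_apply f, h]

/-- Second quantization of a unitary transformation of the modes, on Fock space. -/
def fockTransform [NeZero L] : PhotonSpace ≃ₗᵢ[ℂ] PhotonSpace :=
  (HilbertBasis.mkOfOrthogonalEqBot (orthonormal_coreTransform L σ a ha)
    (span_coreTransform_orthogonal σ a ha)).repr.symm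

theorem fockTransform_toFock [NeZero L] (f : PhotonCore) :
    fockTransform L σ a ha (toFock f) = toFock (coreTransform σ a ha f) := by
  classical
  induction f using Finsupp.induction_linear with
  | zero => simp
  | add f g hf hg => simp only [map_add, hf, hg]
  | single n c =>
    have h1 : fockTransform L σ a ha (toFock (Finsupp.single n 1)) =
        toFock (coreTransform σ a ha (Finsupp.single n 1)) := by
      rw [toFock_single, fockTransform]
      convert HilbertBasis.repr_symm_single _ n using 1
      rw [HilbertBasis.coe_mkOfOrthogonalEqBot]
    rw [← mul_one c, ← smul_eq_mul, ← Finsupp.smul_single, map_smul, map_smul, map_smul, map_smul,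
      h1]

theorem inner_toFock_energy {ψ ψ' : PhotonSpace} (h : ∀ n, ψ' n = (photonEnergy L n : ℂ) * ψ n)
    (f : PhotonCore) : inner ℂ (toFock f) ψ' = inner ℂ (toFock (coreEnergy L f)) ψ := by
  induction f using Finsupp.induction_linear with
  | zero => simp
  | add f g hf hg => simp only [map_add, inner_add_left, hf, hg]
  | single k c =>
    rw [coreEnergy_single, map_smul, inner_smul_left, inner_toFock_single, inner_toFock_single,
      h, Complex.conj_ofReal]
    ring

theorem apply_eq_inner_toFock (ψ : PhotonSpace) (n : Occ) :
    ψ n = inner ℂ (toFock (Finsupp.single n 1)) ψ := by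
  rw [inner_toFock_single, map_one, one_mul]

variable [NeZero L]

theorem inner_fockTransform (f : PhotonCore) (ψ : PhotonSpace) :
    inner ℂ (toFock (coreTransform σ a ha f)) (fockTransform L σ a ha ψ) =
      inner ℂ (toFock f) ψ := by
  rw [← fockTransform_toFock L, LinearIsometryEquiv.inner_map_map]

/-- The unbounded energy is tested against the core, where it commutes with the transformation.
Having `ψ'` as a vector of Fock space expresses that `ψ` lies in the domain. -/
theorem fockTransform_energy (hσ : ∀ p, absMomentum L (σ p) = absMomentum L p)
    {ψ ψ' : PhotonSpace} (h : ∀ n, ψ' n = (photonEnergy L n : ℂ) * ψ n) (n : Occ) :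
    fockTransform L σ a ha ψ' n = (photonEnergy L n : ℂ) * fockTransform L σ a ha ψ n := by
  set T := coreTransform σ a ha
  have h4 : coreEnergy L (T.symm (Finsupp.single n 1)) =
      (photonEnergy L n : ℂ) • T.symm (Finsupp.single n 1) := by
    apply T.injective
    rw [← coreEnergy_coreTransform L σ a ha hσ, map_smul, T.apply_symm_apply, coreEnergy_single]
  rw [apply_eq_inner_toFock, apply_eq_inner_toFock _ n,
    ← T.apply_symm_apply (Finsupp.single n 1), inner_fockTransform, inner_fockTransform,
    inner_toFock_energy L h, h4, map_smul, inner_smul_left, Complex.conj_ofReal]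

theorem fockTransform_symm_energy (hσ : ∀ p, absMomentum L (σ p) = absMomentum L p)
    {ψ ψ' : PhotonSpace} (h : ∀ n, ψ' n = (photonEnergy L n : ℂ) * ψ n) (n : Occ) :
    (fockTransform L σ a ha).symm ψ' n =
      (photonEnergy L n : ℂ) * (fockTransform L σ a ha).symm ψ n := by
  rw [apply_eq_inner_toFock, apply_eq_inner_toFock _ n,
    ← inner_fockTransform L σ a ha _ (LinearIsometryEquiv.symm _ ψ'),
    ← inner_fockTransform L σ a ha _ (LinearIsometryEquiv.symm _ ψ),
    LinearIsometryEquiv.apply_symm_apply, LinearIsometryEquiv.apply_symm_apply, inner_toFock_energy L h,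
    coreEnergy_coreTransform L σ a ha hσ, coreEnergy_single, map_smul, map_smul, inner_smul_left,
    Complex.conj_ofReal]

end ModeTransformations

/-! ### Permutations of fermionic one-particle states. -/

section FermionTransform

variable {F : Type} [Fintype F]

/-- The sign of the pair `f, g` under a permutation of the one-particle states. -/
def inversionSign (π : F ≃ F) (f g : F) : ℂ :=
  if Fintype.equivFin F f < Fintype.equivFin F g ∧
      Fintype.equivFin F (π g) < Fintype.equivFin F (π f) then -1 else 1

/-- The sign of the occupation number state `S` under a permutation of the one-particle states:
`-1` to the number of inversions in `S`. -/
def confSign (π : F ≃ F) (S : Finset F) : ℂ := ∏ f ∈ S, ∏ g ∈ S, inversionSign π f g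

theorem confSign_eq (π : F ≃ F) (S : Finset F) : confSign π S = 1 ∨ confSign π S = -1 := by
  have h : ∀ f g, inversionSign π f g * inversionSign π f g = 1 := fun f g => by
    unfold inversionSign; split_ifs <;> norm_num
  rw [← mul_self_eq_one_iff, confSign, ← Finset.prod_mul_distrib]
  refine Finset.prod_eq_one fun f _ => ?_
  rw [← Finset.prod_mul_distrib]
  exact Finset.prod_eq_one fun g _ => h f g

theorem confSign_insert [DecidableEq F] (π : F ≃ F) {f : F} {S : Finset F} (hf : f ∉ S) :
    confSign π (insert f S) =
      (∏ g ∈ S, inversionSign π f g * inversionSign π g f) * confSign π S := by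
  have h : inversionSign π f f = 1 := by simp [inversionSign]
  simp only [confSign, Finset.prod_insert hf, Finset.prod_mul_distrib, h]
  ring

theorem neg_one_pow_card_filter_lt [DecidableEq F] {f : F} {S : Finset F} (hf : f ∉ S) :
    (-1 : ℂ) ^ ((insert f S).filter
        fun g => Fintype.equivFin F g < Fintype.equivFin F f).card =
      ∏ g ∈ S, if Fintype.equivFin F g < Fintype.equivFin F f then (-1 : ℂ) else 1 := by
  rw [← Finset.prod_const, Finset.prod_filter, Finset.prod_insert hf, if_neg (lt_irrefl _),
    one_mul]

/-- Removing `f` from a configuration changes its inversion count by the inversions between `f` and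
the rest. Their parity is exactly the discrepancy between the Jordan-Wigner signs before and after
relabelling. -/
theorem fermiAnn_map [DecidableEq F] (π : F ≃ F) (f : F) (S S' : Finset F) :
    fermiAnn (π f) (π.finsetCongr S) (π.finsetCongr S') =
      confSign π S * confSign π S' * fermiAnn f S S' := by
  have h1 : π f ∈ π.finsetCongr S' ↔ f ∈ S' := by simp
  have h2 : π.finsetCongr S = (π.finsetCongr S').erase (π f) ↔ S = S'.erase f := by
    rw [← π.finsetCongr.injective.eq_iff (a := S)]
    simp [Finset.map_erase]
  simp only [fermiAnn, h1, h2]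
  split_ifs with h
  · obtain ⟨hf, rfl⟩ := h
    obtain ⟨T, hT, rfl⟩ : ∃ T, f ∉ T ∧ insert f T = S' :=
      ⟨S'.erase f, Finset.notMem_erase f S', Finset.insert_erase hf⟩
    rw [Finset.erase_insert hT, neg_one_pow_card_filter_lt hT]
    have e : π.finsetCongr (insert f T) = insert (π f) (π.finsetCongr T) := by
      simp [Finset.map_insert]
    rw [e, neg_one_pow_card_filter_lt (by simpa using hT), confSign_insert π hT]
    have hs : confSign π T * confSign π T = 1 := by
      rcases confSign_eq π T with h | h <;> rw [h] <;> norm_num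
    have hp : (∏ g ∈ π.finsetCongr T,
        if Fintype.equivFin F g < Fintype.equivFin F (π f) then (-1 : ℂ) else 1) =
        (∏ g ∈ T, inversionSign π f g * inversionSign π g f) *
          ∏ g ∈ T, if Fintype.equivFin F g < Fintype.equivFin F f then (-1 : ℂ) else 1 := by
      rw [← Finset.prod_mul_distrib, Equiv.finsetCongr_apply, Finset.prod_map]
      refine Finset.prod_congr rfl fun g hg => ?_
      have hne : Fintype.equivFin F g ≠ Fintype.equivFin F f := by
        intro h
        exact hT ((Fintype.equivFin F).injective h ▸ hg)
      have hne' : Fintype.equivFin F (π g) ≠ Fintype.equivFin F (π f) := by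
        intro h
        exact hT (π.injective ((Fintype.equivFin F).injective h) ▸ hg)
      simp only [inversionSign, Equiv.coe_toEmbedding]
      rcases lt_or_gt_of_ne hne with h | h <;> rcases lt_or_gt_of_ne hne' with h' | h' <;>
        simp [h, h', h.not_gt, h'.not_gt]
    rw [hp]
    calc _ = (confSign π T * confSign π T) * _ := by rw [hs, one_mul]
      _ = _ := by ring
  · simp

end FermionTransform

/-! ### Conjugation by signed permutation matrices. -/

section SignedConjugation

variable {ι : Type*}

/-- `X'` is the conjugate of `X` by the signed permutation matrix of `e` and `s`. -/
def SignedConj (e : ι ≃ ι) (s : ι → ℂ) (X X' : Matrix ι ι ℂ) : Prop :=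
  ∀ S S', X' (e S) (e S') = s S * s S' * X S S'

variable {e : ι ≃ ι} {s : ι → ℂ} {X X' Y Y' : Matrix ι ι ℂ}

theorem SignedConj.mul [Fintype ι] (hs : ∀ S, s S = 1 ∨ s S = -1) (hX : SignedConj e s X X')
    (hY : SignedConj e s Y Y') : SignedConj e s (X * Y) (X' * Y') := by
  intro S S'
  rw [Matrix.mul_apply, Matrix.mul_apply, ← e.sum_comp, Finset.mul_sum]
  refine Finset.sum_congr rfl fun T _ => ?_
  have : s T * s T = 1 := by rcases hs T with h | h <;> rw [h] <;> norm_num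
  rw [hX, hY]
  linear_combination (s S * X S T * s S' * Y T S') * this

theorem SignedConj.sub (hX : SignedConj e s X X') (hY : SignedConj e s Y Y') :
    SignedConj e s (X - Y) (X' - Y') := by
  intro S S'
  rw [Matrix.sub_apply, Matrix.sub_apply, hX, hY, mul_sub]

theorem SignedConj.smul (c : ℂ) (hX : SignedConj e s X X') :
    SignedConj e s (c • X) (c • X') := by
  intro S S'
  rw [Matrix.smul_apply, Matrix.smul_apply, hX, smul_eq_mul, smul_eq_mul]
  ring

theorem SignedConj.sum {κ : Type*} (t : Finset κ) {X X' : κ → Matrix ι ι ℂ}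
    (hX : ∀ k, SignedConj e s (X k) (X' k)) :
    SignedConj e s (∑ k ∈ t, X k) (∑ k ∈ t, X' k) := by
  intro S S'
  rw [Matrix.sum_apply, Matrix.sum_apply, Finset.mul_sum]
  exact Finset.sum_congr rfl fun k _ => hX k S S'

theorem signedConj_one [DecidableEq ι] (hs : ∀ S, s S = 1 ∨ s S = -1) : SignedConj e s 1 1 := by
  intro S S'
  by_cases h : S = S'
  · subst h
    rcases hs S with h | h <;> simp [h]
  · simp [h]

theorem SignedConj.conjTranspose (hs : ∀ S, s S = 1 ∨ s S = -1) (hX : SignedConj e s X X') :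
    SignedConj e s X.conjTranspose X'.conjTranspose := by
  intro S S'
  have h : ∀ S, star (s S) = s S := fun S => by rcases hs S with h | h <;> simp [h]
  rw [Matrix.conjTranspose_apply, Matrix.conjTranspose_apply, hX, star_mul', star_mul', h, h]
  ring

end SignedConjugation

/-! ### Unitaries on the full Hilbert space. -/

section SpaceTransform

variable {L : ℕ} [NeZero L]

theorem Obs.act_apply (X : Obs L) (ψ : Space L) (S : FConf L) :
    X.act ψ S = ∑ S', X S S' (ψ S') := rfl

theorem Obs.act_add (X Y : Obs L) : (X + Y).act = X.act + Y.act := by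
  ext1 ψ
  ext1 S
  simp [Obs.act_apply, Finset.sum_add_distrib]

theorem Obs.act_smul (c : ℂ) (X : Obs L) : (c • X).act = c • X.act := by
  ext1 ψ
  ext1 S
  simp [Obs.act_apply, Finset.smul_sum]

theorem Obs.act_neg (X : Obs L) : (-X).act = -X.act := by
  ext1 ψ
  ext1 S
  simp [Obs.act_apply]

theorem Obs.act_zero : (0 : Obs L).act = 0 := by
  ext1 ψ
  ext1 S
  simp [Obs.act_apply]

theorem Obs.act_sum {κ : Type*} (t : Finset κ) (X : κ → Obs L) :
    (∑ k ∈ t, X k).act = ∑ k ∈ t, (X k).act := by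
  classical
  induction t using Finset.induction_on with
  | empty => simp [Obs.act_zero]
  | insert k t hk ih => rw [Finset.sum_insert hk, Finset.sum_insert hk, Obs.act_add, ih]

open Classical in
/-- The unitary operator given by a signed permutation of the electron configurations and a unitary
operator on the photon Fock space. -/
def spaceTransform (e : FConf L ≃ FConf L) (s : FConf L → ℂ)
    (G : PhotonSpace ≃ₗᵢ[ℂ] PhotonSpace) : Space L ≃ₗᵢ[ℂ] Space L :=
  (LinearIsometryEquiv.piLpCongrRight 2 fun S =>
    if s S = 1 then G else G.trans (LinearIsometryEquiv.neg ℂ)).trans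
    (LinearIsometryEquiv.piLpCongrLeft 2 ℂ PhotonSpace e)

variable {e : FConf L ≃ FConf L} {s : FConf L → ℂ} {G : PhotonSpace ≃ₗᵢ[ℂ] PhotonSpace}

theorem spaceTransform_apply (hs : ∀ S, s S = 1 ∨ s S = -1) (ψ : Space L) (S : FConf L) :
    spaceTransform e s G ψ (e S) = s S • G (ψ S) := by
  have h : spaceTransform e s G ψ (e S) =
      (if s S = 1 then G else G.trans (LinearIsometryEquiv.neg ℂ)) (ψ S) := by
    simp [spaceTransform, LinearIsometryEquiv.piLpCongrLeft_apply]
  rw [h]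
  rcases hs S with h | h
  · simp [h]
  · have : (-1 : ℂ) ≠ 1 := by norm_num
    simp [h, this]

theorem spaceTransform_tensorOp (hs : ∀ S, s S = 1 ∨ s S = -1)
    {X X' : Matrix (FConf L) (FConf L) ℂ} {V V' : PhotonSpace →L[ℂ] PhotonSpace}
    (hX : SignedConj e s X X') (hV : ∀ ψ, G (V ψ) = V' (G ψ)) (ψ : Space L) :
    spaceTransform e s G ((tensorOp X V).act ψ) =
      (tensorOp X' V').act (spaceTransform e s G ψ) := by
  ext1 T
  obtain ⟨S, rfl⟩ := e.surjective T
  rw [spaceTransform_apply hs, Obs.act_apply, Obs.act_apply, map_sum, Finset.smul_sum,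
    ← e.sum_comp fun T => tensorOp X' V' (e S) T (spaceTransform e s G ψ T)]
  refine Finset.sum_congr rfl fun S' _ => ?_
  have : s S' * s S' = 1 := by rcases hs S' with h | h <;> rw [h] <;> norm_num
  simp only [tensorOp, Matrix.map_apply, smul_apply, map_smul,
    spaceTransform_apply hs, hX S S', hV, smul_smul]
  congr 1
  linear_combination -(s S * X S S') * this

end SpaceTransform

/-! ### Symmetries of the model and invariance of averages. -/

section ModelSymmetry

variable {L : ℕ}

/-- The permutation of the sites given by permutations of the cells of the two sublattices. -/
def siteEquiv (α γ : Cell L ≃ Cell L) : Site L ≃ Site L where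
  toFun s := if s.1 = 0 then (0, α s.2) else (1, γ s.2)
  invFun s := if s.1 = 0 then (0, α.symm s.2) else (1, γ.symm s.2)
  left_inv s := by
    obtain ⟨k, x⟩ := s
    fin_cases k <;> simp
  right_inv s := by
    obtain ⟨k, x⟩ := s
    fin_cases k <;> simp

theorem siteEquiv_zero (α γ : Cell L ≃ Cell L) (x : Cell L) :
    siteEquiv α γ (0, x) = (0, α x) := rfl

theorem siteEquiv_one (α γ : Cell L ≃ Cell L) (x : Cell L) :
    siteEquiv α γ (1, x) = (1, γ x) := rfl

/-- The permutation of the one-particle states of the electrons given by a permutation of the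
sites. -/
def orbitalEquiv (ς : Site L ≃ Site L) : Orbital L ≃ Orbital L := ς.prodCongr (Equiv.refl _)

theorem Model.coreTransform_bondField (m : Model L) (σ : Momentum ≃ Momentum)
    (w : Momentum → Matrix (Fin 2) (Fin 2) ℂ)
    (hw : ∀ p, (w p).conjTranspose * (w p).conjTranspose.conjTranspose = 1)
    {x x' : Cell L} {i i' : Fin 3}
    (hf : ∀ p r, m.fieldCoeff x' i' (σ p) r = ∑ r', w p r r' * m.fieldCoeff x i p r')
    (f : PhotonCore) :
    coreTransform σ (fun p => (w p).conjTranspose) hw (m.bondField x i f) =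
      m.bondField x' i' (coreTransform σ (fun p => (w p).conjTranspose) hw f) := by
  set T := coreTransform σ (fun p => (w p).conjTranspose) hw with hT
  -- Conjugation by `T` is an additive equivalence and σ reindexes momenta, so the identity holds
  -- mode by mode. The transformation matrix is the adjoint of `w` because creation operators carry
  -- conjugated coefficients.
  have h : m.bondField x' i' = T.conj (m.bondField x i) := by
    rw [Model.bondField, Model.bondField, AddEquivClass.map_finsum, ← finsum_comp_equiv σ]
    refine finsum_congr fun p => LinearMap.ext fun g => ?_
    obtain ⟨f, rfl⟩ := T.surjective g
    rw [LinearEquiv.conj_apply_apply, T.symm_apply_apply]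
    simp only [LinearMap.add_apply, LinearMap.smul_apply, map_add,
      map_smul, hT, coreTransform_photonAnn, coreTransform_photonCre, hf, Fin.sum_univ_two,
      Matrix.conjTranspose_apply, star_star, star_add, star_mul']
    module
  rw [h, LinearEquiv.conj_apply_apply, T.symm_apply_apply]

/-- A symmetry of the model: permutations of the cells of the two sublattices, of the directions of
the bonds and of the photon momenta, and rotations of the polarizations, compatible with the
geometry, the photon field and the Coulomb potential. -/
structure Model.Symmetry (m : Model L) where
  cellA : Cell L ≃ Cell L
  cellB : Cell L ≃ Cell L
  dir : Fin 3 ≃ Fin 3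
  mom : Momentum ≃ Momentum
  pol : Momentum → Matrix (Fin 2) (Fin 2) ℂ
  cellB_neighbour : ∀ x i, cellB (neighbourCell x i) = neighbourCell (cellA x) (dir i)
  absMomentum_mom : ∀ p, absMomentum L (mom p) = absMomentum L p
  pol_unitary : ∀ p, (pol p).conjTranspose * pol p = 1
  fieldCoeff_mom : ∀ x i p r, m.fieldCoeff (cellA x) (dir i) (mom p) r =
    ∑ r', pol p r r' * m.fieldCoeff x i p r'
  coulomb_site : ∀ s s', m.coulomb (sitePos (siteEquiv cellA cellB s) -
    sitePos (siteEquiv cellA cellB s')) = m.coulomb (sitePos s - sitePos s')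

namespace Model.Symmetry

variable {m : Model L} (Y : m.Symmetry)

theorem conjTranspose_unitary (p : Momentum) :
    (Y.pol p).conjTranspose * (Y.pol p).conjTranspose.conjTranspose = 1 := by
  rw [Matrix.conjTranspose_conjTranspose, Y.pol_unitary]

end Model.Symmetry

variable [NeZero L]

/-- `X'` is the conjugate of `X` by the second quantization of a permutation of the sites. -/
def SiteConj (ς : Site L ≃ Site L) (X X' : Matrix (FConf L) (FConf L) ℂ) : Prop :=
  SignedConj (orbitalEquiv ς).finsetCongr (confSign (orbitalEquiv ς)) X X'

variable (ς : Site L ≃ Site L)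

theorem siteConj_ann (s : Site L) (τ : Fin 2) : SiteConj ς (ann s τ) (ann (ς s) τ) :=
  fun S S' => fermiAnn_map (orbitalEquiv ς) (s, τ) S S'

theorem siteConj_cre (s : Site L) (τ : Fin 2) : SiteConj ς (cre s τ) (cre (ς s) τ) :=
  (siteConj_ann ς s τ).conjTranspose (confSign_eq _)

theorem siteConj_hop (s s' : Site L) (τ : Fin 2) :
    SiteConj ς (cre s τ * ann s' τ) (cre (ς s) τ * ann (ς s') τ) :=
  (siteConj_cre ς s τ).mul (confSign_eq _) (siteConj_ann ς s' τ)

theorem siteConj_density (s : Site L) : SiteConj ς (density s) (density (ς s)) :=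
  SignedConj.sum _ fun τ => siteConj_hop ς s s τ

theorem Model.siteConj_coulombEnergy (m : Model L)
    (hc : ∀ s s', m.coulomb (sitePos (ς s) - sitePos (ς s')) =
      m.coulomb (sitePos s - sitePos s')) :
    SiteConj ς m.coulombEnergy m.coulombEnergy := by
  have h : m.coulombEnergy = ((m.e ^ 2 / 2 : ℝ) : ℂ) • ∑ s : Site L, ∑ s' : Site L,
      m.coulomb (sitePos s - sitePos s') • ((density (ς s) - 1) * (density (ς s') - 1)) := by
    rw [Model.coulombEnergy, ← ς.sum_comp]
    congr 1
    refine Finset.sum_congr rfl fun s _ => ?_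
    rw [← ς.sum_comp]
    exact Finset.sum_congr rfl fun s' _ => by rw [hc]
  have hd : ∀ s, SiteConj ς (density s - 1) (density (ς s) - 1) := fun s =>
    (siteConj_density ς s).sub (signedConj_one (confSign_eq _))
  intro S S'
  nth_rewrite 1 [h]
  exact SignedConj.smul _ (SignedConj.sum _ fun s => SignedConj.sum _ fun s' =>
    SignedConj.smul _ ((hd s).mul (confSign_eq _) (hd s'))) S S'

namespace Model.Symmetry

variable {m : Model L} (Y : m.Symmetry)

/-- The action of a symmetry on the photon Fock space. -/
def photonUnitary : PhotonSpace ≃ₗᵢ[ℂ] PhotonSpace :=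
  fockTransform L Y.mom (fun p => (Y.pol p).conjTranspose) Y.conjTranspose_unitary

/-- The action of a symmetry on the Hilbert space. -/
def unitary : Space L ≃ₗᵢ[ℂ] Space L :=
  spaceTransform (orbitalEquiv (siteEquiv Y.cellA Y.cellB)).finsetCongr
    (confSign (orbitalEquiv (siteEquiv Y.cellA Y.cellB))) Y.photonUnitary

theorem photonUnitary_expI (θ : ℝ) (x : Cell L) (i : Fin 3) (ψ : PhotonSpace) :
    Y.photonUnitary (expI θ (m.bondField x i) ψ) =
      expI θ (m.bondField (Y.cellA x) (Y.dir i)) (Y.photonUnitary ψ) :=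
  expI_conj θ _ _ (fockTransform_toFock L Y.mom _ Y.conjTranspose_unitary)
    (m.coreTransform_bondField Y.mom Y.pol Y.conjTranspose_unitary
      fun p r => Y.fieldCoeff_mom x i p r) ψ

theorem unitary_tensorOp {X X' : Matrix (FConf L) (FConf L) ℂ}
    {V V' : PhotonSpace →L[ℂ] PhotonSpace}
    (hX : SiteConj (siteEquiv Y.cellA Y.cellB) X X')
    (hV : ∀ ψ, Y.photonUnitary (V ψ) = V' (Y.photonUnitary ψ)) (ψ : Space L) :
    Y.unitary ((tensorOp X V).act ψ) = (tensorOp X' V').act (Y.unitary ψ) :=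
  spaceTransform_tensorOp (confSign_eq _) hX hV ψ

theorem unitary_bondOp (x : Cell L) (i : Fin 3) (ψ : Space L) :
    Y.unitary ((m.bondOp x i).act ψ) =
      (m.bondOp (Y.cellA x) (Y.dir i)).act (Y.unitary ψ) := by
  have h : ∀ s s' τ, SiteConj (siteEquiv Y.cellA Y.cellB) (cre s τ * ann s' τ) _ :=
    siteConj_hop (siteEquiv Y.cellA Y.cellB)
  simp only [Model.bondOp, Obs.act_sum, Obs.act_add, LinearMap.sum_apply, LinearMap.add_apply,
    map_sum, map_add, ← Y.cellB_neighbour]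
  refine Finset.sum_congr rfl fun τ _ => congrArg₂ _ ?_ ?_
  · exact Y.unitary_tensorOp (h (0, x) (1, neighbourCell x i) τ) (Y.photonUnitary_expI _ x i) ψ
  · exact Y.unitary_tensorOp (h (1, neighbourCell x i) (0, x) τ) (Y.photonUnitary_expI _ x i) ψ

theorem unitary_boundedPart {φ φ' : Cell L → Fin 3 → ℝ}
    (hφ : ∀ x i, φ' (Y.cellA x) (Y.dir i) = φ x i) (ψ : Space L) :
    Y.unitary ((m.boundedPart φ).act ψ) = (m.boundedPart φ').act (Y.unitary ψ) := by
  have h : ∑ x : Cell L, ∑ i : Fin 3, ((m.t + φ' x i : ℝ) : ℂ) • m.bondOp x i =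
      ∑ x : Cell L, ∑ i : Fin 3,
        ((m.t + φ x i : ℝ) : ℂ) • m.bondOp (Y.cellA x) (Y.dir i) := by
    rw [← Y.cellA.sum_comp]
    refine Finset.sum_congr rfl fun x _ => ?_
    rw [← Y.dir.sum_comp]
    exact Finset.sum_congr rfl fun i _ => by rw [hφ]
  simp only [Model.boundedPart, h, Obs.act_add, Obs.act_neg, Obs.act_sum, Obs.act_smul,
    LinearMap.add_apply, LinearMap.neg_apply, LinearMap.sum_apply, LinearMap.smul_apply,
    map_add, map_neg, map_sum, map_smul, Y.unitary_bondOp]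
  congr 1
  exact Y.unitary_tensorOp (m.siteConj_coulombEnergy _ Y.coulomb_site) (fun _ => rfl) ψ

theorem unitary_apply (ψ : Space L) (S : FConf L) :
    Y.unitary ψ ((orbitalEquiv (siteEquiv Y.cellA Y.cellB)).finsetCongr S) =
      confSign (orbitalEquiv (siteEquiv Y.cellA Y.cellB)) S • Y.photonUnitary (ψ S) :=
  spaceTransform_apply (confSign_eq _) ψ S

theorem unitary_photonHamiltonian {ψ : Space L} (hψ : ψ ∈ (photonHamiltonian L).domain) :
    ∃ h : Y.unitary ψ ∈ (photonHamiltonian L).domain,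
      photonHamiltonian L ⟨Y.unitary ψ, h⟩ = Y.unitary (photonHamiltonian L ⟨ψ, hψ⟩) := by
  have key : ∀ T n, Y.unitary (photonHamiltonian L ⟨ψ, hψ⟩) T n =
      (photonEnergy L n : ℂ) * Y.unitary ψ T n := by
    intro T n
    obtain ⟨S, rfl⟩ := (orbitalEquiv (siteEquiv Y.cellA Y.cellB)).finsetCongr.surjective T
    rw [unitary_apply, unitary_apply, lp.coeFn_smul, lp.coeFn_smul, Pi.smul_apply,
      Pi.smul_apply, smul_eq_mul, smul_eq_mul, mul_left_comm]
    congr 1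
    exact fockTransform_energy L Y.mom _ Y.conjTranspose_unitary Y.absMomentum_mom
      (fun n => rfl) n
  have hmem : Y.unitary ψ ∈ (photonHamiltonian L).domain := by
    intro T
    have h := lp.memℓp (Y.unitary (photonHamiltonian L ⟨ψ, hψ⟩) T)
    rwa [funext (key T)] at h
  refine ⟨hmem, ?_⟩
  ext T n
  exact (key T n).symm

/-- The converse inclusion needs the inverse photon unitary to commute with the energy; the
fermionic sign is cancelled by multiplying with it once more. -/
theorem unitary_mem_domain_iff (ψ : Space L) :
    Y.unitary ψ ∈ (photonHamiltonian L).domain ↔ ψ ∈ (photonHamiltonian L).domain := by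
  refine ⟨fun h S => ?_, fun h => (Y.unitary_photonHamiltonian h).1⟩
  let ς := orbitalEquiv (siteEquiv Y.cellA Y.cellB)
  have h1 : Memℓp (fun n => (photonEnergy L n : ℂ) * Y.photonUnitary (ψ S) n) 2 := by
    have h2 := (h (ς.finsetCongr S)).const_smul (confSign ς S)
    convert h2 using 1
    ext n
    rw [Pi.smul_apply, unitary_apply, lp.coeFn_smul, Pi.smul_apply, smul_eq_mul, smul_eq_mul]
    have : confSign ς S * confSign ς S = 1 := by
      rcases confSign_eq ς S with h | h <;> rw [h] <;> norm_num
    linear_combination -(photonEnergy L n * Y.photonUnitary (ψ S) n) * this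
  have h2 := fockTransform_symm_energy L Y.mom _ Y.conjTranspose_unitary Y.absMomentum_mom
    (ψ := Y.photonUnitary (ψ S)) (ψ' := ⟨_, h1⟩) (fun n => rfl)
  have h3 := lp.memℓp (Y.photonUnitary.symm ⟨_, h1⟩)
  have h4 : Y.photonUnitary.symm (Y.photonUnitary (ψ S)) = ψ S :=
    Y.photonUnitary.symm_apply_apply _
  change ∀ n, Y.photonUnitary.symm _ n = _ * Y.photonUnitary.symm (Y.photonUnitary (ψ S)) n at h2
  rw [h4] at h2
  rwa [funext h2] at h3

/-- Averages of bond operators are invariant under symmetries. -/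
theorem average_bondOp (β : ℝ) {φ φ' : Cell L → Fin 3 → ℝ}
    (hφ : ∀ x i, φ' (Y.cellA x) (Y.dir i) = φ x i) (x : Cell L) (i : Fin 3) :
    m.average β φ' (m.bondOp (Y.cellA x) (Y.dir i)) = m.average β φ (m.bondOp x i) := by
  refine gibbsAverage_eq_of_intertwining (H := m.hamiltonian φ) (H' := m.hamiltonian φ')
    Y.unitary Y.unitary_mem_domain_iff ?_
    (Y.unitary_bondOp x i) β
  intro ψ hψ hψ'
  obtain ⟨_, h⟩ := Y.unitary_photonHamiltonian hψ
  change photonHamiltonian L ⟨Y.unitary ψ, hψ'⟩ + (m.boundedPart φ').act (Y.unitary ψ) =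
    Y.unitary (photonHamiltonian L ⟨ψ, hψ⟩ + (m.boundedPart φ).act ψ)
  rw [map_add, h, Y.unitary_boundedPart hφ]

end Model.Symmetry

end ModelSymmetry

/-! ### Symmetry of the bond operators and of the Hamiltonian. -/

section SelfAdjointness

theorem isOrtho_eigenspace {V : Type} [NormedAddCommGroup V] [InnerProductSpace ℂ V]
    {H : V →ₗ.[ℂ] V} (hH : ∀ v w : H.domain, inner ℂ (H v) (w : V) = inner ℂ (v : V) (H w))
    (E E' : ℝ) (hE : E ≠ E') : eigenspace H E ⟂ eigenspace H E' := by
  rw [Submodule.isOrtho_iff_inner_eq]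
  intro v hv w hw
  obtain ⟨hv, hv'⟩ := mem_eigenspace.1 hv
  obtain ⟨hw, hw'⟩ := mem_eigenspace.1 hw
  have h := hH ⟨v, hv⟩ ⟨w, hw⟩
  rw [hv', hw', inner_smul_left, inner_smul_right, Complex.conj_ofReal] at h
  have h2 : ((E : ℂ) - E') * inner ℂ v w = 0 := by linear_combination h
  exact (mul_eq_zero.1 h2).resolve_left (sub_ne_zero.2 (Complex.ofReal_injective.ne hE))

variable {L : ℕ}

theorem Model.star_coulomb (m : Model L) (y : Fin 2 → ℝ) : star (m.coulomb y) = m.coulomb (-y) := by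
  rw [Model.coulomb, Model.coulomb, star_mul']
  congr 1
  · exact Complex.conj_ofReal _
  · change starAddEquiv (∑ᶠ p : Momentum, _) = _
    rw [AddEquiv.map_finsum]
    refine finsum_congr fun p => ?_
    change (starRingEnd ℂ) _ = _
    rw [map_mul, Complex.conj_ofReal, ← Complex.exp_conj, map_neg, map_mul, Complex.conj_I,
      Complex.conj_ofReal, dotProduct_neg]
    push_cast
    congr 2
    ring

theorem photonHamiltonian_apply (ψ : (photonHamiltonian L).domain) (S : FConf L) (n : Occ) :
    photonHamiltonian L ψ S n = (photonEnergy L n : ℂ) * (ψ : Space L) S n := rfl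

theorem photonEnergy_nonneg (n : Occ) : 0 ≤ photonEnergy L n :=
  Finset.sum_nonneg fun _ _ => mul_nonneg (Nat.cast_nonneg _) (Real.sqrt_nonneg _)

variable [NeZero L]

theorem inner_tensorOp_act (X : Matrix (FConf L) (FConf L) ℂ) (V : PhotonSpace →L[ℂ] PhotonSpace)
    (ψ ψ' : Space L) :
    inner ℂ ((tensorOp X V).act ψ) ψ' =
      inner ℂ ψ ((tensorOp X.conjTranspose (ContinuousLinearMap.adjoint V)).act ψ') := by
  rw [PiLp.inner_apply, PiLp.inner_apply]
  simp only [Obs.act_apply, sum_inner, inner_sum, tensorOp, Matrix.map_apply, smul_apply,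
    inner_smul_left, inner_smul_right, ContinuousLinearMap.adjoint_inner_right,
    Matrix.conjTranspose_apply]
  exact Finset.sum_comm

theorem conjTranspose_hop (s s' : Site L) (τ : Fin 2) :
    (cre s τ * ann s' τ).conjTranspose = cre s' τ * ann s τ := by
  rw [Matrix.conjTranspose_mul, cre, cre, ann, ann, fermiCre, fermiCre,
    Matrix.conjTranspose_conjTranspose]

variable (m : Model L)

/-- The two hopping terms are adjoint to each other, the phase of opposite charge being the adjoint
of the phase. -/
theorem Model.isSymmetric_bondOp (x : Cell L) (i : Fin 3) : (m.bondOp x i).act.IsSymmetric := by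
  intro ψ ψ'
  simp only [Model.bondOp, Obs.act_sum, Obs.act_add, LinearMap.sum_apply, LinearMap.add_apply,
    sum_inner, inner_sum, inner_add_left, inner_add_right]
  refine Finset.sum_congr rfl fun τ _ => ?_
  rw [inner_tensorOp_act, inner_tensorOp_act, conjTranspose_hop, conjTranspose_hop,
    expI_neg (m.isCoreSymmetric_bondField x i), ContinuousLinearMap.adjoint_adjoint, add_comm]

theorem conjTranspose_density (s : Site L) : (density s).conjTranspose = density s := by
  rw [density, Matrix.conjTranspose_sum]
  exact Finset.sum_congr rfl fun τ _ => conjTranspose_hop s s τ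

theorem Model.conjTranspose_coulombEnergy : m.coulombEnergy.conjTranspose = m.coulombEnergy := by
  rw [Model.coulombEnergy, Matrix.conjTranspose_smul, Complex.star_def, Complex.conj_ofReal]
  congr 1
  simp only [Matrix.conjTranspose_sum, Matrix.conjTranspose_smul, Matrix.conjTranspose_mul,
    Matrix.conjTranspose_sub, conjTranspose_density, Matrix.conjTranspose_one, Model.star_coulomb,
    neg_sub]
  exact Finset.sum_comm

theorem Model.isSymmetric_boundedPart (φ : Cell L → Fin 3 → ℝ) :
    (m.boundedPart φ).act.IsSymmetric := by
  have hid : ContinuousLinearMap.adjoint (ContinuousLinearMap.id ℂ PhotonSpace) =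
      ContinuousLinearMap.id ℂ PhotonSpace := ContinuousLinearMap.adjoint_id
  have h1 : (tensorOp m.coulombEnergy (ContinuousLinearMap.id ℂ PhotonSpace)).act.IsSymmetric := by
    intro ψ ψ'
    rw [inner_tensorOp_act, m.conjTranspose_coulombEnergy, hid]
  have h2 : (∑ x : Cell L, ∑ i : Fin 3,
      ((m.t + φ x i : ℝ) : ℂ) • m.bondOp x i).act.IsSymmetric := by
    intro ψ ψ'
    simp only [Obs.act_sum, Obs.act_smul, LinearMap.sum_apply, LinearMap.smul_apply, sum_inner,
      inner_sum, inner_smul_left, inner_smul_right, Complex.conj_ofReal,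
      m.isSymmetric_bondOp _ _ ψ ψ']
  intro ψ ψ'
  rw [Model.boundedPart, Obs.act_add, Obs.act_neg, LinearMap.add_apply, LinearMap.add_apply,
    LinearMap.neg_apply, LinearMap.neg_apply, inner_add_left, inner_add_right, inner_neg_left,
    inner_neg_right, h1, h2]

theorem inner_photonHamiltonian (ψ ψ' : (photonHamiltonian L).domain) :
    inner ℂ (photonHamiltonian L ψ) (ψ' : Space L) =
      inner ℂ (ψ : Space L) (photonHamiltonian L ψ') := by
  rw [PiLp.inner_apply, PiLp.inner_apply]
  refine Finset.sum_congr rfl fun S _ => ?_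
  rw [lp.inner_eq_tsum, lp.inner_eq_tsum]
  refine tsum_congr fun n => ?_
  rw [photonHamiltonian_apply, photonHamiltonian_apply, ← smul_eq_mul, ← smul_eq_mul,
    inner_smul_left, inner_smul_right, Complex.conj_ofReal]

theorem Model.inner_hamiltonian (φ : Cell L → Fin 3 → ℝ) (ψ ψ' : (m.hamiltonian φ).domain) :
    inner ℂ (m.hamiltonian φ ψ) (ψ' : Space L) =
      inner ℂ (ψ : Space L) (m.hamiltonian φ ψ') := by
  change inner ℂ (photonHamiltonian L ψ + (m.boundedPart φ).act (ψ : Space L)) (ψ' : Space L) =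
    inner ℂ (ψ : Space L) (photonHamiltonian L ψ' + (m.boundedPart φ).act (ψ' : Space L))
  rw [inner_add_left, inner_add_right]
  exact congrArg₂ _ (inner_photonHamiltonian ψ ψ') (m.isSymmetric_boundedPart φ _ _)

/-- A bound for the norm of a bounded operator. -/
def Obs.bound (X : Obs L) : ℝ := ∑ S, ∑ S', ‖X S S'‖

theorem Obs.bound_nonneg (X : Obs L) : 0 ≤ X.bound :=
  Finset.sum_nonneg fun _ _ => Finset.sum_nonneg fun _ _ => norm_nonneg _

theorem Obs.norm_inner_act_le (X : Obs L) (ψ : Space L) (hψ : ‖ψ‖ = 1) :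
    ‖inner ℂ ψ (X.act ψ)‖ ≤ X.bound := by
  have h : ∀ S, ‖ψ S‖ ≤ 1 := fun S => hψ ▸ PiLp.norm_apply_le ψ S
  rw [PiLp.inner_apply]
  refine norm_sum_le_of_le _ fun S _ => ?_
  rw [Obs.act_apply, inner_sum]
  refine norm_sum_le_of_le _ fun S' _ => ?_
  calc ‖inner ℂ (ψ S) (X S S' (ψ S'))‖ ≤ ‖ψ S‖ * ‖X S S' (ψ S')‖ := norm_inner_le_norm _ _
    _ ≤ 1 * (‖X S S'‖ * ‖ψ S'‖) :=
        mul_le_mul (h S) ((X S S').le_opNorm _) (norm_nonneg _) zero_le_one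
    _ ≤ 1 * (‖X S S'‖ * 1) := by gcongr; exact h S'
    _ = ‖X S S'‖ := by ring

end SelfAdjointness

/-! ### The Peierls inequality and linearity of averages. -/

section PeierlsInequality

variable {L : ℕ}

theorem hasSum_sq_norm (ψ : PhotonSpace) : HasSum (fun n => ‖ψ n‖ ^ 2) (‖ψ‖ ^ 2) := by
  have := lp.hasSum_norm (p := 2) (by norm_num) ψ
  simpa using this

theorem summable_sq_norm_mul_exp {β : ℝ} (hβ : 0 < β) (ψ : PhotonSpace) :
    Summable fun n => ‖ψ n‖ ^ 2 * Real.exp (-(β * photonEnergy L n)) := by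
  refine Summable.of_nonneg_of_le (fun n => by positivity) (fun n => ?_) (hasSum_sq_norm ψ).summable
  refine mul_le_of_le_one_right (sq_nonneg _) (Real.exp_le_one_iff.2 ?_)
  have := mul_nonneg hβ.le (photonEnergy_nonneg (L := L) n)
  linarith

variable [NeZero L]

/-- Jensen's inequality for the Gibbs weight in a vector of the domain of the photon energy. -/
theorem exp_neg_le_sum_tsum {β a : ℝ} (hβ : 0 < β) (ψ : (photonHamiltonian L).domain)
    (hψ : ‖(ψ : Space L)‖ = 1)
    (ha : (inner ℂ (ψ : Space L) (photonHamiltonian L ψ)).re ≤ a) :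
    Real.exp (-(β * a)) ≤
      ∑ S, ∑' n, ‖(ψ : Space L) S n‖ ^ 2 * Real.exp (-(β * photonEnergy L n)) := by
  set ψ₀ : Space L := (ψ : Space L) with hψ₀
  have hE : ∀ S, HasSum (fun n => photonEnergy L n * ‖ψ₀ S n‖ ^ 2)
      (inner ℂ (ψ₀ S) (photonHamiltonian L ψ S)).re := by
    intro S
    have := Complex.hasSum_re (lp.hasSum_inner (𝕜 := ℂ) (ψ₀ S) (photonHamiltonian L ψ S))
    convert this using 2 with n
    rw [photonHamiltonian_apply, ← smul_eq_mul (photonEnergy L n : ℂ), inner_smul_right,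
      Complex.re_ofReal_mul, ← hψ₀]
    congr 1
    rw [inner_self_eq_norm_sq_to_K]
    norm_cast
  have h1 : ∀ S, Real.exp (-(β * a)) * ((1 + β * a) * ‖ψ₀ S‖ ^ 2 -
      β * (inner ℂ (ψ₀ S) (photonHamiltonian L ψ S)).re) ≤
      ∑' n, ‖ψ₀ S n‖ ^ 2 * Real.exp (-(β * photonEnergy L n)) := by
    intro S
    refine hasSum_le (fun n => ?_) ((((hasSum_sq_norm (ψ₀ S)).mul_left (1 + β * a)).sub
      ((hE S).mul_left β)).mul_left (Real.exp (-(β * a))))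
      (summable_sq_norm_mul_exp hβ (ψ₀ S)).hasSum
    -- The tangent line of the exponential at energy `a` bounds each Boltzmann weight from below;
    -- averaged over |ψ|², only the norm and the mean energy survive.
    have h2 := Real.add_one_le_exp (β * a - β * photonEnergy L n)
    have h3 : Real.exp (-(β * photonEnergy L n)) =
        Real.exp (-(β * a)) * Real.exp (β * a - β * photonEnergy L n) := by
      rw [← Real.exp_add]; congr 1; ring
    rw [h3]
    have h4 := mul_le_mul_of_nonneg_left h2
      (mul_nonneg (Real.exp_nonneg (-(β * a))) (sq_nonneg ‖ψ₀ S n‖))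
    calc _ = Real.exp (-(β * a)) * ‖ψ₀ S n‖ ^ 2 * (β * a - β * photonEnergy L n + 1) := by ring
      _ ≤ _ := h4
      _ = _ := by ring
  refine le_trans ?_ (Finset.sum_le_sum fun S _ => h1 S)
  rw [← Finset.mul_sum, Finset.sum_sub_distrib, ← Finset.mul_sum, ← Finset.mul_sum]
  have hn : ∑ S, ‖ψ₀ S‖ ^ 2 = 1 := by
    rw [← PiLp.norm_sq_eq_of_L2, hψ, one_pow]
  have hm : ∑ S, (inner ℂ (ψ₀ S) (photonHamiltonian L ψ S)).re ≤ a := by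
    rwa [PiLp.inner_apply, Complex.re_sum] at ha
  rw [hn]
  refine le_mul_of_one_le_right (Real.exp_nonneg _) ?_
  nlinarith

/-- Bessel's inequality for a single occupation number state. -/
theorem sum_sq_norm_apply_le_one {ι : Type} [Fintype ι] {v : ι → Space L} (hv : Orthonormal ℂ v)
    (S : FConf L) (n : Occ) : ∑ k, ‖v k S n‖ ^ 2 ≤ 1 := by
  classical
  have h := hv.sum_inner_products_le (s := Finset.univ)
    (PiLp.single 2 S (lp.single 2 n (1 : ℂ)) : Space L)
  rw [PiLp.norm_single, lp.norm_single (by norm_num), norm_one, one_pow] at h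
  refine le_trans (le_of_eq (Finset.sum_congr rfl fun k _ => ?_)) h
  rw [← norm_inner_symm, PiLp.inner_apply, Finset.sum_eq_single S]
  · rw [PiLp.single_eq_same, lp.inner_single_left]
    simp
  · intro T _ hT
    rw [PiLp.single_eq_of_ne _ hT, inner_zero_left]
  · simp

/-- In an eigenvector of energy `E k` the mean photon energy is at most `E k + C`, as the remaining
part of the Hamiltonian is bounded. Jensen's inequality for each eigenvector and Bessel's for their
sum give the photon partition function, once per electron configuration. -/
theorem Model.sum_exp_eigenvalues_le (m : Model L) {β : ℝ} (hβ : 0 < β) (φ : Cell L → Fin 3 → ℝ)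
    {ι : Type} [Fintype ι] {v : ι → Space L} {E : ι → ℝ} (hv : Orthonormal ℂ v)
    (hE : ∀ k, v k ∈ eigenspace (m.hamiltonian φ) (E k)) :
    ∑ k, Real.exp (-(β * E k)) ≤ Real.exp (β * (m.boundedPart φ).bound) *
      ∑ _S : FConf L, ∑' n, Real.exp (-(β * photonEnergy L n)) := by
  set C := (m.boundedPart φ).bound
  have h1 : ∀ k, Real.exp (-(β * (E k + C))) ≤
      ∑ S, ∑' n, ‖v k S n‖ ^ 2 * Real.exp (-(β * photonEnergy L n)) := by
    intro k
    obtain ⟨hd, he⟩ := mem_eigenspace.1 (hE k)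
    refine exp_neg_le_sum_tsum hβ ⟨v k, hd⟩ (hv.1 k) ?_
    have h2 : photonHamiltonian L ⟨v k, hd⟩ =
        (E k : ℂ) • v k - (m.boundedPart φ).act (v k) := by
      rw [← he]
      exact (add_sub_cancel_right _ _).symm
    have h3 := (Complex.abs_re_le_norm _).trans
      ((m.boundedPart φ).norm_inner_act_le (v k) (hv.1 k))
    rw [h2, inner_sub_right, inner_smul_right, inner_self_eq_norm_sq_to_K, hv.1 k]
    have h4 := neg_le_of_abs_le h3
    simp only [Complex.sub_re, RCLike.ofReal_one, one_pow, mul_one, Complex.ofReal_re]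
    linarith
  have h2 : ∑ k, Real.exp (-(β * (E k + C))) ≤
      ∑ _S : FConf L, ∑' n, Real.exp (-(β * photonEnergy L n)) := by
    refine (Finset.sum_le_sum fun k _ => h1 k).trans ?_
    rw [Finset.sum_comm]
    refine Finset.sum_le_sum fun S _ => ?_
    rw [← Summable.tsum_finsetSum fun k _ => summable_sq_norm_mul_exp hβ (v k S)]
    refine Summable.tsum_le_tsum (fun n => ?_)
      (summable_sum fun k _ => summable_sq_norm_mul_exp hβ (v k S))
      (summable_exp_neg_photonEnergy L hβ)
    rw [← Finset.sum_mul]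
    exact mul_le_of_le_one_left (Real.exp_nonneg _) (sum_sq_norm_apply_le_one hv S n)
  calc ∑ k, Real.exp (-(β * E k))
      = Real.exp (β * C) * ∑ k, Real.exp (-(β * (E k + C))) := by
        rw [Finset.mul_sum]
        refine Finset.sum_congr rfl fun k _ => ?_
        rw [← Real.exp_add]
        congr 1
        ring
    _ ≤ _ := mul_le_mul_of_nonneg_left h2 (Real.exp_nonneg _)

/-- The average is linear. -/
theorem Model.average_sum_smul (m : Model L) {β : ℝ} (hβ : 0 < β) (φ : Cell L → Fin 3 → ℝ)
    {κ : Type*} (s : Finset κ) (c : κ → ℂ) (X : κ → Obs L) :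
    m.average β φ (∑ k ∈ s, c k • X k) = ∑ k ∈ s, c k * m.average β φ (X k) := by
  simp only [Model.average, Obs.act_sum, Obs.act_smul]
  exact gibbsAverage_sum_smul s c _ fun k _ =>
    summable_gibbsTrace (isOrtho_eigenspace (m.inner_hamiltonian φ))
      (fun ι _ v E hv hE => m.sum_exp_eigenvalues_le hβ φ hv hE) (X k).bound_nonneg
      (X k).norm_inner_act_le

theorem Model.conj_average_bondOp (m : Model L) (β : ℝ) (φ : Cell L → Fin 3 → ℝ) (x : Cell L)
    (i : Fin 3) :
    (starRingEnd ℂ) (m.average β φ (m.bondOp x i)) = m.average β φ (m.bondOp x i) :=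
  conj_gibbsAverage (m.isSymmetric_bondOp x i)

end PeierlsInequality

/-! ### Change of polarization basis. -/

section Polarizations

/-- Two orthonormal pairs of vectors orthogonal to the same real direction differ by a unitary
matrix. -/
theorem exists_polarization_change {u : Fin 3 → ℝ} (hu : u ⬝ᵥ u = 1) {e e' : Fin 2 → Fin 3 → ℂ}
    (he : ∀ r r', star (e r) ⬝ᵥ e r' = if r = r' then 1 else 0)
    (he' : ∀ r r', star (e' r) ⬝ᵥ e' r' = if r = r' then 1 else 0)
    (heu : ∀ r, e r ⬝ᵥ (fun k => (u k : ℂ)) = 0) (heu' : ∀ r, e' r ⬝ᵥ (fun k => (u k : ℂ)) = 0) :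
    ∃ w : Matrix (Fin 2) (Fin 2) ℂ, w.conjTranspose * w = 1 ∧
      ∀ r, e' r = ∑ r', w r r' • e r' := by
  set v : Fin 3 → ℂ := fun k => (u k : ℂ) with hv
  have hstar : star v = v := by ext k; simp [hv]
  have hvv : v ⬝ᵥ v = 1 := by
    simp only [dotProduct, hv] at hu ⊢
    exact_mod_cast hu
  have hve : ∀ r, v ⬝ᵥ star (e r) = 0 := fun r => by
    have := congrArg star (heu r)
    rwa [← Matrix.star_dotProduct_star, hstar, star_zero] at this
  -- The pair completed by the real direction is an orthonormal basis of ℂ³; a vector `e' r`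
  -- orthogonal to that direction has zero third coordinate in it.
  let E : Matrix (Fin 3) (Fin 3) ℂ := Matrix.of ![e 0, e 1, v]
  have hE0 : E 0 = e 0 := rfl
  have hE1 : E 1 = e 1 := rfl
  have hE2 : E 2 = v := rfl
  have hE : E * E.conjTranspose = 1 := by
    ext k l
    have hkl : (E * E.conjTranspose) k l = E k ⬝ᵥ star (E l) := by
      rw [Matrix.mul_apply]
      rfl
    have hee : ∀ r r', e r ⬝ᵥ star (e r') = if r' = r then 1 else 0 := fun r r' => by
      rw [dotProduct_comm, he]
    rw [hkl]
    fin_cases k <;> fin_cases l <;> simp [hE0, hE1, hE2, hee, heu, hve, hvv, hstar]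
  have hE' : E.conjTranspose * E = 1 := mul_eq_one_comm.1 hE
  let w : Matrix (Fin 2) (Fin 2) ℂ := fun r r' => e' r ⬝ᵥ star (e r')
  have hw : ∀ r, e' r = ∑ r', w r r' • e r' := by
    intro r
    have h1 : e' r = Matrix.vecMul (Matrix.vecMul (e' r) E.conjTranspose) E := by
      rw [Matrix.vecMul_vecMul, hE', Matrix.vecMul_one]
    have h2 : Matrix.vecMul (e' r) E.conjTranspose = ![w r 0, w r 1, 0] := by
      ext k
      have : Matrix.vecMul (e' r) E.conjTranspose k = e' r ⬝ᵥ star (E k) := rfl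
      rw [this]
      fin_cases k <;> simp [hE0, hE1, hE2, w, heu', hstar]
    rw [h2] at h1
    rw [h1]
    ext k
    simp [Matrix.vecMul, dotProduct, Fin.sum_univ_three, E]
  refine ⟨w, mul_eq_one_comm.1 ?_, hw⟩
  ext r s
  have h1 := he' s r
  nth_rewrite 1 [hw s] at h1
  rw [hw r] at h1
  simp only [star_sum, star_smul, sum_dotProduct, dotProduct_sum, smul_dotProduct, dotProduct_smul,
    he, smul_eq_mul] at h1
  rw [Matrix.mul_apply, Matrix.one_apply]
  simp only [Matrix.conjTranspose_apply]
  simp only [mul_ite, mul_one, mul_zero, Finset.sum_ite_eq', Finset.mem_univ,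
    if_true] at h1
  simpa only [eq_comm] using h1

end Polarizations

/-! ### Plane waves on the periodic lattice. -/

section PlaneWaves

variable {L : ℕ}

/-- The plane wave of the photons with momentum label `p` at the planar position `y`. -/
def planeWave (L : ℕ) (p : Momentum) (y : Fin 2 → ℝ) : ℂ :=
  Complex.exp (-(Complex.I * ((planar L p ⬝ᵥ y : ℝ) : ℂ)))

theorem planeWave_add (p : Momentum) (y z : Fin 2 → ℝ) :
    planeWave L p (y + z) = planeWave L p y * planeWave L p z := by
  rw [planeWave, planeWave, planeWave, dotProduct_add, ← Complex.exp_add]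
  congr 1
  push_cast
  ring

theorem planeWave_ne_zero (p : Momentum) (y : Fin 2 → ℝ) : planeWave L p y ≠ 0 :=
  Complex.exp_ne_zero _

theorem planeWave_sub (p : Momentum) (y z : Fin 2 → ℝ) :
    planeWave L p (y - z) = planeWave L p y / planeWave L p z := by
  rw [eq_div_iff (planeWave_ne_zero p z), ← planeWave_add, sub_add_cancel]

theorem sqrt_three_mul_self : √3 * √3 = (3 : ℝ) := Real.mul_self_sqrt (by norm_num)

theorem planar_dotProduct_cellPos (p : Momentum) (x : Cell L) :
    planar L p ⬝ᵥ cellPos x =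
      2 * Real.pi * ((p.1.1 : ℝ) * x.1.val + (p.1.2.1 : ℝ) * x.2.val) / L := by
  simp only [planar, cellPos, b₁, b₂, a₁, a₂, dotProduct, Fin.sum_univ_two, Matrix.cons_val_zero,
    Matrix.cons_val_one, Pi.add_apply, Pi.smul_apply, smul_eq_mul]
  linear_combination (Real.pi / 3 * ((p.1.1 : ℝ) / L - (p.1.2.1 : ℝ) / L) *
    ((x.1.val : ℝ) - x.2.val)) * sqrt_three_mul_self

theorem planar_dotProduct_δ (p : Momentum) (i : Fin 3) :
    planar L p ⬝ᵥ δ i = 2 * Real.pi / (3 * L) *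
      (![(p.1.1 : ℝ) + p.1.2.1, p.1.1 - 2 * p.1.2.1, p.1.2.1 - 2 * p.1.1] : Fin 3 → ℝ) i := by
  fin_cases i
  · simp [planar, b₁, b₂, δ, dotProduct, Fin.sum_univ_two]
    ring
  · simp [planar, b₁, b₂, δ, dotProduct, Fin.sum_univ_two]
    linear_combination (Real.pi / 3 * ((p.1.1 : ℝ) / L - (p.1.2.1 : ℝ) / L)) * sqrt_three_mul_self
  · simp [planar, b₁, b₂, δ, dotProduct, Fin.sum_univ_two]
    linear_combination (-Real.pi / 3 * ((p.1.1 : ℝ) / L - (p.1.2.1 : ℝ) / L)) * sqrt_three_mul_self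

variable [NeZero L]

/-- `cellPos` picks representatives and is not additive, but allowed momenta pair with L𝔹 in 2πℤ.
Plane waves are therefore characters of the cell group, which handles the boundary conditions. -/
theorem planeWave_cellPos (p : Momentum) (x : Cell L) :
    planeWave L p (cellPos x) =
      ZMod.stdAddChar (-((p.1.1 : ZMod L) * x.1 + (p.1.2.1 : ZMod L) * x.2)) := by
  have h : (-((p.1.1 : ZMod L) * x.1 + (p.1.2.1 : ZMod L) * x.2)) =
      ((-(p.1.1 * (x.1.val : ℤ) + p.1.2.1 * (x.2.val : ℤ)) : ℤ) : ZMod L) := by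
    push_cast
    rw [ZMod.natCast_zmod_val, ZMod.natCast_zmod_val]
  rw [h, ZMod.stdAddChar_coe, planeWave, planar_dotProduct_cellPos]
  congr 1
  push_cast
  ring

theorem planeWave_cellPos_add (p : Momentum) (x y : Cell L) :
    planeWave L p (cellPos (x + y)) = planeWave L p (cellPos x) * planeWave L p (cellPos y) := by
  rw [planeWave_cellPos, planeWave_cellPos, planeWave_cellPos, ← AddChar.map_add_eq_mul]
  congr 1
  simp only [Prod.fst_add, Prod.snd_add]
  ring

theorem planeWave_cellPos_mul_star (p : Momentum) (x : Cell L) :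
    star (planeWave L p (cellPos x)) * planeWave L p (cellPos x) = 1 := by
  rw [Complex.star_def, mul_comm, Complex.mul_conj, Complex.normSq_eq_norm_sq, planeWave_cellPos,
    AddChar.norm_apply]
  norm_num

end PlaneWaves

/-! ### The rotation by 2π/3 on vectors and momenta. -/

section Rotation

/-- The rotation by `2π/3` around the third axis. -/
def rotate (v : Fin 3 → ℂ) : Fin 3 → ℂ :=
  ![-(1 / 2) * v 0 - (√3 : ℝ) / 2 * v 1, (√3 : ℝ) / 2 * v 0 - 1 / 2 * v 1, v 2]

theorem ofReal_sqrt_three_mul_self : ((√3 : ℝ) : ℂ) * ((√3 : ℝ) : ℂ) = 3 := by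
  rw [← Complex.ofReal_mul, sqrt_three_mul_self]
  norm_num

theorem rotate_dotProduct_rotate (v u : Fin 3 → ℂ) : rotate v ⬝ᵥ rotate u = v ⬝ᵥ u := by
  simp only [rotate, dotProduct, Fin.sum_univ_three, Matrix.cons_val_zero, Matrix.cons_val_one,
    Matrix.cons_val]
  linear_combination (1 / 4 * (v 0 * u 0 + v 1 * u 1)) * ofReal_sqrt_three_mul_self

theorem star_rotate (v : Fin 3 → ℂ) : star (rotate v) = rotate (star v) := by
  ext k
  fin_cases k <;> simp [rotate]

theorem δ_dotProduct_rotate (i : Fin 3) (v : Fin 3 → ℂ) :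
    (δ (i + 1) 0 : ℂ) * rotate v 0 + (δ (i + 1) 1 : ℂ) * rotate v 1 =
      (δ i 0 : ℂ) * v 0 + (δ i 1 : ℂ) * v 1 := by
  fin_cases i
  · simp [δ, rotate]
    linear_combination (1 / 4 * v 0) * ofReal_sqrt_three_mul_self
  · simp [δ, rotate]
    linear_combination (-1 / 4 * v 0) * ofReal_sqrt_three_mul_self
  · simp [δ, rotate]
    ring

/-- The rotation by `2π/3` on momentum labels. -/
def rotateMomentum : Momentum ≃ Momentum :=
  Equiv.subtypeEquiv
    { toFun := fun n => (n.2.1 - n.1, -n.1, n.2.2)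
      invFun := fun n => (-n.2.1, n.1 - n.2.1, n.2.2)
      left_inv := fun n => by ext <;> simp
      right_inv := fun n => by ext <;> simp }
    (by
      rintro ⟨a, b, c⟩
      simp only [ne_eq, Prod.mk_eq_zero, Equiv.coe_fn_mk, not_iff_not]
      omega)

theorem rotateMomentum_val (p : Momentum) :
    (rotateMomentum p).1 = (p.1.2.1 - p.1.1, -p.1.1, p.1.2.2) := rfl

theorem absMomentum_rotateMomentum (L : ℕ) (p : Momentum) :
    absMomentum L (rotateMomentum p) = absMomentum L p := by
  rw [absMomentum, absMomentum, momentum_dotProduct_self, momentum_dotProduct_self,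
    rotateMomentum_val]
  congr 2
  push_cast
  ring

theorem momentum_rotateMomentum (L : ℕ) (p : Momentum) :
    (fun k => (momentum L (rotateMomentum p) k : ℂ)) =
      rotate fun k => (momentum L p k : ℂ) := by
  ext k
  fin_cases k
  · simp [momentum, rotate, planar, b₁, b₂, rotateMomentum_val]
    linear_combination (-(Real.pi : ℂ) / 3 * ((p.1.2.1 : ℂ) / L - (p.1.1 : ℂ) / L)) *
      ofReal_sqrt_three_mul_self
  · simp [momentum, rotate, planar, b₁, b₂, rotateMomentum_val]
    ring
  · simp [momentum, rotate, rotateMomentum_val]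

theorem planar_rotateMomentum_dotProduct_δ (L : ℕ) (p : Momentum) (i : Fin 3) :
    planar L (rotateMomentum p) ⬝ᵥ δ (i + 1) = planar L p ⬝ᵥ δ i := by
  rw [planar_dotProduct_δ, planar_dotProduct_δ, rotateMomentum_val]
  congr 1
  fin_cases i
  · simp; ring
  · simp; ring
  · simp; ring

end Rotation

/-! ### Translations and the rotation as symmetries of the model. -/

section Symmetries

variable {L : ℕ} (m : Model L)

/-- The chosen polarizations at the rotated momentum and the rotated polarizations at `p` are both
orthonormal and transverse to the same momentum, which can be normalized since it is nonzero. -/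
theorem Model.exists_polarization_rotation [NeZero L] (p : Momentum) :
    ∃ w : Matrix (Fin 2) (Fin 2) ℂ, w.conjTranspose * w = 1 ∧
      ∀ r, m.ε (rotateMomentum p) r = ∑ r', w r r' • rotate (m.ε p r') := by
  have hq : absMomentum L (rotateMomentum p) ≠ 0 := (absMomentum_pos _).ne'
  set q := momentum L (rotateMomentum p) with hq'
  set u : Fin 3 → ℝ := (absMomentum L (rotateMomentum p))⁻¹ • q with hu'
  have hu : u ⬝ᵥ u = 1 := by
    have h : q ⬝ᵥ q = absMomentum L (rotateMomentum p) ^ 2 := by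
      rw [absMomentum, Real.sq_sqrt]
      exact Finset.sum_nonneg fun k _ => mul_self_nonneg _
    rw [hu', smul_dotProduct, dotProduct_smul, h, smul_eq_mul, smul_eq_mul]
    field_simp
  have hcast : (fun k => (u k : ℂ)) =
      ((absMomentum L (rotateMomentum p) : ℂ))⁻¹ • fun k => (q k : ℂ) := by
    ext k
    simp [hu']
  refine exists_polarization_change hu (fun r r' => ?_) (m.ε_orthonormal _) (fun r => ?_)
    (fun r => ?_)
  · rw [star_rotate, rotate_dotProduct_rotate, m.ε_orthonormal]
  · rw [hcast, dotProduct_smul, hq', momentum_rotateMomentum, rotate_dotProduct_rotate,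
      m.ε_transverse, smul_zero]
  · rw [hcast, dotProduct_smul, hq', m.ε_transverse, smul_zero]

theorem Model.fieldCoeff_eq (x : Cell L) (i : Fin 3) (p : Momentum) (r : Fin 2) :
    m.fieldCoeff x i p r =
      ((1 / (area L * L) * √(m.cutoff (absMomentum L p) / (2 * absMomentum L p)) : ℝ) : ℂ) *
        (((δ i 0 : ℂ) * m.ε p r 0 + (δ i 1 : ℂ) * m.ε p r 1) * (planeWave L p (cellPos x) *
          ∫ s in (0 : ℝ)..1, planeWave L p (s • δ i))) := by
  have h : (∫ s in (0 : ℝ)..1, planeWave L p (cellPos x + s • δ i)) =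
      planeWave L p (cellPos x) * ∫ s in (0 : ℝ)..1, planeWave L p (s • δ i) := by
    simp only [planeWave_add, intervalIntegral.integral_const_mul]
  rw [← h, ← intervalIntegral.integral_const_mul]
  rfl

theorem Model.coulomb_eq_of_planeWave (σ : Momentum ≃ Momentum)
    (hσ : ∀ p, absMomentum L (σ p) = absMomentum L p) {y y' : Fin 2 → ℝ}
    (h : ∀ p, planeWave L (σ p) y' = planeWave L p y) : m.coulomb y' = m.coulomb y := by
  rw [Model.coulomb, Model.coulomb, ← finsum_comp_equiv σ]
  congr 1
  refine finsum_congr fun p => ?_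
  rw [hσ]
  exact congrArg _ (h p)

theorem site_cases {P : Site L → Prop} (h0 : ∀ x, P (0, x)) (h1 : ∀ x, P (1, x)) (s : Site L) :
    P s := by
  obtain ⟨k, x⟩ := s
  fin_cases k
  · exact h0 x
  · exact h1 x

theorem sitePos_zero (x : Cell L) : sitePos ((0, x) : Site L) = cellPos x := rfl

theorem sitePos_one (x : Cell L) : sitePos ((1, x) : Site L) = cellPos x + δ 0 := rfl

theorem planeWave_rotate_smul_δ (p : Momentum) (i : Fin 3) (s : ℝ) :
    planeWave L (rotateMomentum p) (s • δ (i + 1)) = planeWave L p (s • δ i) := by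
  rw [planeWave, planeWave, dotProduct_smul, dotProduct_smul, planar_rotateMomentum_dotProduct_δ]

variable [NeZero L]

/-- Translations are symmetries. -/
def Model.translation (d : Cell L) : m.Symmetry where
  cellA := Equiv.addRight d
  cellB := Equiv.addRight d
  dir := Equiv.refl _
  mom := Equiv.refl _
  -- A translation leaves momenta and polarizations alone and only multiplies the field by a phase.
  pol p := planeWave L p (cellPos d) • 1
  cellB_neighbour x i := by
    fin_cases i <;> simp [neighbourCell, Prod.ext_iff] <;> ring
  absMomentum_mom _ := rfl
  pol_unitary p := by
    rw [Matrix.conjTranspose_smul, Matrix.conjTranspose_one, smul_mul_smul_comm,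
      planeWave_cellPos_mul_star, one_mul, one_smul]
  fieldCoeff_mom x i p r := by
    simp only [Equiv.coe_addRight, Equiv.refl_apply, Matrix.smul_apply, Matrix.one_apply,
      smul_eq_mul, mul_ite, mul_one, mul_zero, ite_mul, zero_mul, Finset.sum_ite_eq,
      Finset.mem_univ, if_true, m.fieldCoeff_eq, planeWave_cellPos_add]
    ring
  coulomb_site s s' := by
    have h : ∀ (p : Momentum) (s : Site L), planeWave L p (sitePos (siteEquiv
        (Equiv.addRight d) (Equiv.addRight d) s)) =
        planeWave L p (cellPos d) * planeWave L p (sitePos s) := by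
      refine fun p => site_cases (fun x => ?_) (fun x => ?_)
      · rw [siteEquiv_zero, sitePos_zero, sitePos_zero, Equiv.coe_addRight,
          planeWave_cellPos_add, mul_comm]
      · rw [siteEquiv_one, sitePos_one, sitePos_one, Equiv.coe_addRight, planeWave_add,
          planeWave_add, planeWave_cellPos_add]
        ring
    refine m.coulomb_eq_of_planeWave (Equiv.refl _) (fun _ => rfl) fun p => ?_
    rw [Equiv.refl_apply, planeWave_sub, planeWave_sub, h, h,
      mul_div_mul_left _ _ (planeWave_ne_zero p _)]

/-- The rotation by `2π/3` around an `A` site, on the cells of the `A` sublattice. -/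
def rotateCell : Cell L ≃ Cell L where
  toFun x := (x.2, -x.1 - x.2)
  invFun x := (-x.1 - x.2, x.1)
  left_inv x := Prod.ext (show -x.2 - (-x.1 - x.2) = x.1 by ring) rfl
  right_inv x := Prod.ext rfl (show -(-x.1 - x.2) - x.1 = x.2 by ring)

theorem planeWave_rotateCell (p : Momentum) (x : Cell L) :
    planeWave L (rotateMomentum p) (cellPos (rotateCell x)) = planeWave L p (cellPos x) := by
  rw [planeWave_cellPos, planeWave_cellPos, rotateMomentum_val]
  congr 1
  simp only [rotateCell, Equiv.coe_fn_mk]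
  push_cast
  ring

/-- From δ₂ − δ₁ = −a₂. Rotation sends the B site x + δ₁ to Rx + δ₂ = (Rx − a₂) + δ₁, hence the
shift by `(0, 1)` in the cells of the B sublattice. -/
theorem planeWave_cellPos_sub_add_δ (p : Momentum) (x : Cell L) :
    planeWave L p (cellPos (x - (0, 1)) + δ 0) = planeWave L p (cellPos x + δ 1) := by
  have h1 : planeWave L p (cellPos x) =
      planeWave L p (cellPos (x - (0, 1))) * planeWave L p (cellPos ((0, 1) : Cell L)) := by
    rw [← planeWave_cellPos_add, sub_add_cancel]
  have h2 : planeWave L p (cellPos ((0, 1) : Cell L)) =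
      Complex.exp (-(Complex.I * ((2 * Real.pi * (p.1.2.1 : ℝ) / L : ℝ) : ℂ))) := by
    have h : -((p.1.1 : ZMod L) * 0 + (p.1.2.1 : ZMod L) * 1) = ((-p.1.2.1 : ℤ) : ZMod L) := by
      push_cast
      ring
    rw [planeWave_cellPos, h, ZMod.stdAddChar_coe]
    congr 1
    push_cast
    ring
  have h3 : planeWave L p (δ 0) =
      Complex.exp (-(Complex.I * ((2 * Real.pi * (p.1.2.1 : ℝ) / L : ℝ) : ℂ))) *
        planeWave L p (δ 1) := by
    rw [planeWave, planeWave, planar_dotProduct_δ, planar_dotProduct_δ, ← Complex.exp_add]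
    congr 1
    simp
    ring
  rw [planeWave_add, planeWave_add, h1, h2, h3]
  ring

/-- The rotation by `2π/3` is a symmetry. -/
def Model.rotation : m.Symmetry where
  cellA := rotateCell
  cellB := rotateCell.trans (Equiv.subRight (0, 1))
  dir := Equiv.addRight 1
  mom := rotateMomentum
  pol p := (m.exists_polarization_rotation p).choose
  cellB_neighbour x i := by
    fin_cases i <;> simp [neighbourCell, rotateCell, Prod.ext_iff] <;> ring
  absMomentum_mom := absMomentum_rotateMomentum L
  pol_unitary p := (m.exists_polarization_rotation p).choose_spec.1
  fieldCoeff_mom x i p r := by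
    obtain ⟨-, h⟩ := (m.exists_polarization_rotation p).choose_spec
    set w := (m.exists_polarization_rotation p).choose
    have h1 : (δ (i + 1) 0 : ℂ) * m.ε (rotateMomentum p) r 0 +
        (δ (i + 1) 1 : ℂ) * m.ε (rotateMomentum p) r 1 =
        ∑ r', w r r' * ((δ i 0 : ℂ) * m.ε p r' 0 + (δ i 1 : ℂ) * m.ε p r' 1) := by
      rw [h r]
      simp only [Fin.sum_univ_two, Pi.add_apply, Pi.smul_apply, smul_eq_mul]
      linear_combination w r 0 * δ_dotProduct_rotate i (m.ε p 0) +
        w r 1 * δ_dotProduct_rotate i (m.ε p 1)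
    simp only [Equiv.coe_addRight, m.fieldCoeff_eq, h1, absMomentum_rotateMomentum,
      planeWave_rotateCell, planeWave_rotate_smul_δ, Fin.sum_univ_two]
    ring
  coulomb_site s s' := by
    have h : ∀ (p : Momentum) (s : Site L), planeWave L (rotateMomentum p) (sitePos (siteEquiv
        rotateCell (rotateCell.trans (Equiv.subRight (0, 1))) s)) =
        planeWave L p (sitePos s) := by
      refine fun p => site_cases (fun x => ?_) (fun x => ?_)
      · rw [siteEquiv_zero, sitePos_zero, sitePos_zero, planeWave_rotateCell]
      · rw [siteEquiv_one, sitePos_one, sitePos_one, Equiv.trans_apply, Equiv.subRight_apply]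
        have h1 := planeWave_rotate_smul_δ (L := L) p 0 1
        rw [one_smul, one_smul, zero_add] at h1
        rw [planeWave_cellPos_sub_add_δ, planeWave_add, planeWave_add, planeWave_rotateCell, h1]
    refine m.coulomb_eq_of_planeWave rotateMomentum (absMomentum_rotateMomentum L) fun p => ?_
    rw [planeWave_sub, planeWave_sub, h, h]

end Symmetries

/-! ### Kekulé classes and Fourier analysis modulo 3. -/

section Kekule

variable {L : ℕ}

/-- The class of the bond `(x, i)` in the Kekulé pattern with label `j`; the distortion
singles out the bonds of class zero. -/
def kekuleClass (hL : 3 ∣ L) (j : Fin 3) (x : Cell L) (i : Fin 3) : ZMod 3 :=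
  ((i : ℕ) : ZMod 3) - ((j : ℕ) : ZMod 3) -
    (ZMod.castHom hL (ZMod 3) x.1 - ZMod.castHom hL (ZMod 3) x.2)

theorem cos_two_pi_div_three : Real.cos (2 * Real.pi / 3) = -(1 / 2) := by
  rw [show 2 * Real.pi / 3 = Real.pi - Real.pi / 3 by ring, Real.cos_pi_sub,
    Real.cos_pi_div_three]

theorem cos_int_mul_two_pi_div_three (k : ℤ) :
    Real.cos (k * (2 * Real.pi / 3)) = if (k : ZMod 3) = 0 then 1 else -(1 / 2) := by
  have hz : (k : ZMod 3) = 0 ↔ k % 3 = 0 := by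
    rw [ZMod.intCast_zmod_eq_zero_iff_dvd]
    exact Int.dvd_iff_emod_eq_zero
  have hk : (k : ℝ) * (2 * Real.pi / 3) =
      ((k % 3 : ℤ) : ℝ) * (2 * Real.pi / 3) + ((k / 3 : ℤ) : ℝ) * (2 * Real.pi) := by
    have : (k : ℝ) = ((k % 3 : ℤ) : ℝ) + 3 * ((k / 3 : ℤ) : ℝ) := by
      exact_mod_cast (Int.emod_add_mul_ediv k 3).symm
    rw [this]
    ring
  rw [hk, Real.cos_add_int_mul_two_pi]
  simp only [hz]
  have h3 : k % 3 = 0 ∨ k % 3 = 1 ∨ k % 3 = 2 := by omega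
  rcases h3 with h | h | h
  · simp [h]
  · rw [h, if_neg (by norm_num), Int.cast_one, one_mul, cos_two_pi_div_three]
  · rw [h, if_neg (by norm_num), show ((2 : ℤ) : ℝ) * (2 * Real.pi / 3) =
      2 * Real.pi - 2 * Real.pi / 3 by push_cast; ring, Real.cos_two_pi_sub,
      cos_two_pi_div_three]

theorem pF_dotProduct_cellPos (x : Cell L) :
    pF ⬝ᵥ cellPos x = (2 * x.1.val + x.2.val) * (2 * Real.pi / 3) := by
  have h3 : √3 ≠ 0 := by positivity
  simp only [pF, cellPos, a₁, a₂, dotProduct, Fin.sum_univ_two, Matrix.cons_val_zero,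
    Matrix.cons_val_one, Pi.add_apply, Pi.smul_apply, smul_eq_mul]
  field_simp
  ring

variable [NeZero L]

theorem pF_dotProduct_δ (i : Fin 3) : pF ⬝ᵥ δ i = (1 - (i : ℕ)) * (2 * Real.pi / 3) := by
  have h3 : √3 ≠ 0 := by positivity
  fin_cases i
  · simp [pF, δ, dotProduct, Fin.sum_univ_two]
  · simp [pF, δ, dotProduct, Fin.sum_univ_two]
    field_simp
    ring
  · simp [pF, δ, dotProduct, Fin.sum_univ_two]
    field_simp
    ring

theorem kekule_eq (hL : 3 ∣ L) (φ₀ Δ₀ : ℝ) (j : Fin 3) (x : Cell L) (i : Fin 3) :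
    kekule φ₀ Δ₀ j x i =
      φ₀ + 2 / 3 * Δ₀ * if kekuleClass hL j x i = 0 then 1 else -(1 / 2) := by
  have h : pF ⬝ᵥ (δ i - δ j - cellPos x) =
      ((-(i : ℕ) + (j : ℕ) - 2 * x.1.val - x.2.val : ℤ) : ℝ) * (2 * Real.pi / 3) := by
    rw [dotProduct_sub, dotProduct_sub, pF_dotProduct_δ, pF_dotProduct_δ, pF_dotProduct_cellPos]
    push_cast
    ring
  -- Modulo 3 the coefficient 2 is −1. The overall sign is harmless, as only vanishing of the class
  -- matters.
  have hc : ((-(i : ℕ) + (j : ℕ) - 2 * x.1.val - x.2.val : ℤ) : ZMod 3) =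
      -kekuleClass hL j x i := by
    have h3 : (3 : ZMod 3) = 0 := rfl
    rw [kekuleClass, ZMod.castHom_apply, ZMod.castHom_apply, ← ZMod.natCast_val, ← ZMod.natCast_val]
    push_cast
    linear_combination (-(x.1.val : ZMod 3)) * h3
  rw [kekule, h, cos_int_mul_two_pi_div_three, hc]
  simp only [neg_eq_zero]

theorem exp_pF_dotProduct_cellPos (hL : 3 ∣ L) (x : Cell L) :
    Complex.exp (Complex.I * ((pF ⬝ᵥ cellPos x : ℝ) : ℂ)) =
      ZMod.stdAddChar (kekuleClass hL 0 x 0) := by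
  have hc : kekuleClass hL 0 x 0 = ((2 * x.1.val + x.2.val : ℤ) : ZMod 3) := by
    have h3 : (3 : ZMod 3) = 0 := rfl
    rw [kekuleClass, ZMod.castHom_apply, ZMod.castHom_apply, ← ZMod.natCast_val, ← ZMod.natCast_val]
    push_cast
    linear_combination (-(x.1.val : ZMod 3)) * h3
  rw [hc, ZMod.stdAddChar_coe, pF_dotProduct_cellPos]
  congr 1
  push_cast
  ring

/-- Translations in the second lattice direction shift the class by any prescribed amount, so the
classes are equidistributed; averaging over the three shifts gives the formula. -/
theorem sum_kekuleClass (hL : 3 ∣ L) (h : ZMod 3 → ℂ) :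
    ∑ x : Cell L, h (kekuleClass hL 0 x 0) = (Fintype.card (Cell L) : ℂ) / 3 * ∑ c, h c := by
  have hshift : ∀ c : ZMod 3, ∑ x : Cell L, h (kekuleClass hL 0 x 0) =
      ∑ x : Cell L, h (kekuleClass hL 0 x 0 + c) := by
    intro c
    rw [← Equiv.sum_comp (Equiv.addRight ((0, (c.val : ZMod L)) : Cell L))]
    refine Finset.sum_congr rfl fun x _ => congrArg h ?_
    simp only [kekuleClass, Equiv.coe_addRight, Prod.fst_add, Prod.snd_add, map_add, map_natCast,
      add_zero, ZMod.natCast_zmod_val]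
    ring
  have h1 : ∑ c : ZMod 3, ∑ x : Cell L, h (kekuleClass hL 0 x 0) =
      ∑ x : Cell L, ∑ c : ZMod 3, h c := by
    rw [Finset.sum_congr rfl fun c _ => hshift c, Finset.sum_comm]
    exact Finset.sum_congr rfl fun x _ => Equiv.sum_comp (Equiv.addLeft (kekuleClass hL 0 x 0)) h
  rw [Finset.sum_const, Finset.sum_const, nsmul_eq_mul, nsmul_eq_mul, Finset.card_univ,
    Finset.card_univ, ZMod.card] at h1
  push_cast at h1
  linear_combination h1 / 3

theorem natCast_fin_injective {j k : Fin 3} (h : ((j : ℕ) : ZMod 3) = ((k : ℕ) : ZMod 3)) :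
    j = k := by
  revert j k
  decide

theorem exists_fin_natCast_eq (c : ZMod 3) : ∃ j : Fin 3, ((j : ℕ) : ZMod 3) = c :=
  ⟨⟨c.val, c.val_lt⟩, ZMod.natCast_zmod_val c⟩

variable (m : Model L) (β φ₀ Δ₀ : ℝ)

theorem Model.Symmetry.average_kekule (hL : 3 ∣ L) {m : Model L} (Y : m.Symmetry) {j j' : Fin 3}
    (h : ∀ x i, kekuleClass hL j' (Y.cellA x) (Y.dir i) = kekuleClass hL j x i)
    (x : Cell L) (i : Fin 3) :
    m.average β (kekule φ₀ Δ₀ j') (m.bondOp (Y.cellA x) (Y.dir i)) =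
      m.average β (kekule φ₀ Δ₀ j) (m.bondOp x i) :=
  Y.average_bondOp β (fun x i => by rw [kekule_eq hL, kekule_eq hL, h]) x i

theorem Model.average_kekule_translate (hL : 3 ∣ L) {j j' : Fin 3} (x : Cell L) (i : Fin 3)
    (h : ((j' : ℕ) : ZMod 3) = ((j : ℕ) : ZMod 3) +
      (ZMod.castHom hL (ZMod 3) x.1 - ZMod.castHom hL (ZMod 3) x.2)) :
    m.average β (kekule φ₀ Δ₀ j) (m.bondOp x i) =
      m.average β (kekule φ₀ Δ₀ j') (m.bondOp 0 i) := by
  have := (m.translation x).average_kekule β φ₀ Δ₀ hL (j := j') (j' := j) (fun y k => by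
    simp only [Model.translation, kekuleClass, Equiv.coe_addRight, Equiv.refl_apply,
      Prod.fst_add, Prod.snd_add, map_add, h]
    ring) 0 i
  simpa [Model.translation] using this

theorem natCast_fin_add_one (i : Fin 3) : (((i + 1 : Fin 3) : ℕ) : ZMod 3) = (i : ℕ) + 1 := by
  fin_cases i <;> rfl

/-- The rotation replaces x₁ − x₂ by x₁ + 2x₂, which is the same modulo 3, and raises the direction
by one; raising the label by one restores the class. -/
theorem Model.average_kekule_rotate (hL : 3 ∣ L) {j j' : Fin 3} (i : Fin 3)
    (h : ((j : ℕ) : ZMod 3) = ((j' : ℕ) : ZMod 3) + 1) :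
    m.average β (kekule φ₀ Δ₀ j) (m.bondOp 0 (i + 1)) =
      m.average β (kekule φ₀ Δ₀ j') (m.bondOp 0 i) := by
  have := m.rotation.average_kekule β φ₀ Δ₀ hL (j := j') (j' := j) (fun y k => by
    have h3 : (3 : ZMod 3) = 0 := rfl
    simp only [Model.rotation, rotateCell, kekuleClass, Equiv.coe_addRight, Equiv.coe_fn_mk,
      map_sub, map_neg, h, natCast_fin_add_one]
    linear_combination (-(ZMod.castHom hL (ZMod 3) y.2)) * h3) 0 i
  have h0 : rotateCell (0 : Cell L) = 0 := by simp [rotateCell]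
  simpa [Model.rotation, h0] using this

theorem Model.average_kekule_eq (hL : 3 ∣ L) {j j' : Fin 3} (x : Cell L) (i : Fin 3)
    (h : kekuleClass hL j' 0 0 = kekuleClass hL j x i) :
    m.average β (kekule φ₀ Δ₀ j) (m.bondOp x i) =
      m.average β (kekule φ₀ Δ₀ j') (m.bondOp 0 0) := by
  -- `k` is the label once `x` has been translated to the origin, and `k'` the intermediate label
  -- when two rotations are needed.
  obtain ⟨k, hk⟩ := exists_fin_natCast_eq (((j : ℕ) : ZMod 3) +
    (ZMod.castHom hL (ZMod 3) x.1 - ZMod.castHom hL (ZMod 3) x.2))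
  obtain ⟨k', hk'⟩ := exists_fin_natCast_eq (((k : ℕ) : ZMod 3) - 1)
  have h' : ((k : ℕ) : ZMod 3) = ((j' : ℕ) : ZMod 3) + ((i : ℕ) : ZMod 3) := by
    rw [hk]
    simp only [kekuleClass, Prod.fst_zero, Prod.snd_zero, map_zero, Fin.val_zero,
      Nat.cast_zero] at h
    linear_combination h
  rw [m.average_kekule_translate β φ₀ Δ₀ hL x i hk]
  fin_cases i
  · rw [natCast_fin_injective (h'.trans (add_zero _))]
    rfl
  · exact m.average_kekule_rotate β φ₀ Δ₀ hL 0 (by rw [h']; rfl)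
  · refine (m.average_kekule_rotate β φ₀ Δ₀ hL (j' := k') 1 (by rw [hk']; ring)).trans ?_
    refine m.average_kekule_rotate β φ₀ Δ₀ hL 0 ?_
    rw [hk', h']
    push_cast
    ring

/-- The average of a bond operator in presence of a Kekulé distortion depends only on the class of
the bond, and is real. -/
theorem Model.exists_average_kekule_eq (hL : 3 ∣ L) : ∃ f : ZMod 3 → ℝ, ∀ j x i,
    m.average β (kekule φ₀ Δ₀ j) (m.bondOp x i) = (f (kekuleClass hL j x i) : ℂ) := by
  choose J hJ using exists_fin_natCast_eq
  -- The first bond at the origin has class −j, so the label representing −c gives it class `c`.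
  refine ⟨fun c => (m.average β (kekule φ₀ Δ₀ (J (-c))) (m.bondOp 0 0)).re, fun j x i => ?_⟩
  rw [m.average_kekule_eq β φ₀ Δ₀ hL (j' := J (-kekuleClass hL j x i)) x i]
  · exact (Complex.conj_eq_iff_re.1 (m.conj_average_bondOp β _ 0 0)).symm
  · rw [kekuleClass, hJ]
    simp

theorem stdAddChar_three_one :
    ZMod.stdAddChar (1 : ZMod 3) = -(1 / 2) + (√3 : ℝ) / 2 * Complex.I := by
  have h1 : (1 : ZMod 3) = ((1 : ℤ) : ZMod 3) := by simp
  have hs : Real.sin (2 * Real.pi / 3) = √3 / 2 := by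
    rw [show 2 * Real.pi / 3 = Real.pi - Real.pi / 3 by ring, Real.sin_pi_sub,
      Real.sin_pi_div_three]
  have he : 2 * Real.pi * Complex.I * ((1 : ℤ) : ℂ) / ((3 : ℕ) : ℂ) =
      ((2 * Real.pi / 3 : ℝ) : ℂ) * Complex.I := by
    push_cast
    ring
  rw [h1, ZMod.stdAddChar_coe, he, Complex.exp_mul_I, ← Complex.ofReal_cos, ← Complex.ofReal_sin,
    cos_two_pi_div_three, hs]
  push_cast
  ring

theorem stdAddChar_three_two :
    ZMod.stdAddChar (2 : ZMod 3) = -(1 / 2) - (√3 : ℝ) / 2 * Complex.I := by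
  rw [show (2 : ZMod 3) = -1 from rfl, AddChar.map_neg_eq_conj, stdAddChar_three_one]
  simp only [map_add, map_neg, map_div₀, map_mul, map_one, Complex.conj_ofReal, Complex.conj_I,
    Complex.conj_ofNat]
  ring

/-- The gap equation for values depending only on the Kekulé class, in Fourier space. -/
theorem kekule_values_iff_fourier (φ₀ Δ₀ : ℝ) (u : ZMod 3 → ℝ) :
    (∀ c, φ₀ + 2 / 3 * Δ₀ * (if c = 0 then 1 else -(1 / 2)) = u c) ↔
      ((φ₀ : ℂ) = 1 / 3 * ∑ c, (u c : ℂ) ∧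
        ((Δ₀ / 3 : ℝ) : ℂ) = 1 / 3 * ∑ c, ZMod.stdAddChar c * (u c : ℂ)) := by
  have hsum : ∀ F : ZMod 3 → ℂ, ∑ c, F c = F 0 + F 1 + F 2 := fun F => Fin.sum_univ_three F
  have hall : (∀ c : ZMod 3, φ₀ + 2 / 3 * Δ₀ * (if c = 0 then 1 else -(1 / 2)) = u c) ↔
      φ₀ + 2 / 3 * Δ₀ = u 0 ∧ φ₀ - 1 / 3 * Δ₀ = u 1 ∧ φ₀ - 1 / 3 * Δ₀ = u 2 := by
    have h1 : (1 : ZMod 3) ≠ 0 := by decide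
    have h2 : (2 : ZMod 3) ≠ 0 := by decide
    constructor
    · intro h
      have h0 := h 0
      have h1' := h 1
      have h2' := h 2
      rw [if_pos rfl] at h0
      rw [if_neg h1] at h1'
      rw [if_neg h2] at h2'
      exact ⟨by linarith, by linarith, by linarith⟩
    · rintro ⟨h0, h1', h2'⟩ c
      have hc : c = 0 ∨ c = 1 ∨ c = 2 := by revert c; decide
      rcases hc with rfl | rfl | rfl
      · rw [if_pos rfl]; linarith
      · rw [if_neg h1]; linarith
      · rw [if_neg h2]; linarith
  rw [hall, hsum, hsum, AddChar.map_zero_eq_one, stdAddChar_three_one, stdAddChar_three_two]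
  constructor
  · rintro ⟨h0, h1, h2⟩
    rw [← h0, ← h1, ← h2]
    push_cast
    exact ⟨by ring, by ring⟩
  · rintro ⟨h1, h2⟩
    have e1 := congrArg Complex.re h1
    have e2 := congrArg Complex.re h2
    have e3 := congrArg Complex.im h2
    simp at e1 e2 e3
    -- The left side of the second equation is real, so the imaginary part of the Fourier mode
    -- vanishes and `u 1 = u 2`. This supplies the third real equation.
    have h3 : √3 * (u 1 - u 2) = 0 := by linarith
    have h4 : u 1 - u 2 = 0 := (mul_eq_zero.1 h3).resolve_left (by positivity)
    exact ⟨by linarith, by linarith, by linarith⟩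

end Kekule

end Honeycomb

end

/-! ### The gap equation in Fourier space. -/

theorem mainTheorem6 {L : ℕ} [NeZero L] (hL : 3 ∣ L) (m : Honeycomb.Model L)
    (β : ℝ) (hβ : 0 < β) (g κ : ℝ) (hκ : 0 < κ) (φ₀ Δ₀ : ℝ) (j₀ : Fin 3) :
    m.GapEquation β g κ (Honeycomb.kekule φ₀ Δ₀ j₀) ↔
      ((φ₀ : ℂ) = (g ^ 2 / κ : ℝ) * (1 / (Fintype.card (Honeycomb.Cell L) : ℂ)) *
          m.average β (Honeycomb.kekule φ₀ Δ₀ 0) (m.bondOpHat 0 0) ∧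
        ((Δ₀ / 3 : ℝ) : ℂ) = (g ^ 2 / κ : ℝ) * (1 / (Fintype.card (Honeycomb.Cell L) : ℂ)) *
          m.average β (Honeycomb.kekule φ₀ Δ₀ 0) (m.bondOpHat Honeycomb.pF 0)) := by
  obtain ⟨f, hf⟩ := m.exists_average_kekule_eq β φ₀ Δ₀ hL
  have hcard : (Fintype.card (Honeycomb.Cell L) : ℂ) ≠ 0 := Nat.cast_ne_zero.2 Fintype.card_ne_zero
  have hhat0 : m.average β (Honeycomb.kekule φ₀ Δ₀ 0) (m.bondOpHat 0 0) =
      (Fintype.card (Honeycomb.Cell L) : ℂ) / 3 * ∑ c, (f c : ℂ) := by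
    rw [Honeycomb.Model.bondOpHat, m.average_sum_smul hβ,
      ← Honeycomb.sum_kekuleClass hL fun c => (f c : ℂ)]
    refine Finset.sum_congr rfl fun x _ => ?_
    rw [hf]
    simp
  have hhat1 : m.average β (Honeycomb.kekule φ₀ Δ₀ 0) (m.bondOpHat Honeycomb.pF 0) =
      (Fintype.card (Honeycomb.Cell L) : ℂ) / 3 * ∑ c, ZMod.stdAddChar c * (f c : ℂ) := by
    rw [Honeycomb.Model.bondOpHat, m.average_sum_smul hβ,
      ← Honeycomb.sum_kekuleClass hL fun c => ZMod.stdAddChar c * (f c : ℂ)]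
    refine Finset.sum_congr rfl fun x _ => ?_
    rw [hf, Honeycomb.exp_pF_dotProduct_cellPos hL]
  have hgap : m.GapEquation β g κ (Honeycomb.kekule φ₀ Δ₀ j₀) ↔
      ∀ c : ZMod 3, φ₀ + 2 / 3 * Δ₀ * (if c = 0 then 1 else -(1 / 2)) = g ^ 2 / κ * f c := by
    constructor
    · intro h c
      -- The three bonds at the origin already realize all classes.
      obtain ⟨i, hi⟩ := Honeycomb.exists_fin_natCast_eq (c + ((j₀ : ℕ) : ZMod 3))
      have hc : Honeycomb.kekuleClass hL j₀ 0 i = c := by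
        rw [Honeycomb.kekuleClass, hi]
        simp
      have h1 := h 0 i
      rw [hf, Honeycomb.kekule_eq hL, hc] at h1
      exact_mod_cast h1
    · intro h x i
      rw [hf, Honeycomb.kekule_eq hL, h]
      push_cast
      rfl
  rw [hgap, Honeycomb.kekule_values_iff_fourier, hhat0, hhat1]
  have e : ∀ z : ZMod 3 → ℂ, ((g ^ 2 / κ : ℝ) : ℂ) * (1 / (Fintype.card (Honeycomb.Cell L) : ℂ)) *
      ((Fintype.card (Honeycomb.Cell L) : ℂ) / 3 * ∑ c, z c) =
      1 / 3 * ∑ c, ((g ^ 2 / κ : ℝ) : ℂ) * z c := by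
    intro z
    rw [← Finset.mul_sum]
    field_simp
  rw [e, e]
  simp only [Complex.ofReal_mul, mul_left_comm]
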